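/- **Conventions.** A *cpo* is a poset with suprema of all increasing sequences $x_0\le x_1\le\cdots$; a map is *Scott continuous* if it is monotone and preserves these suprema, and, between pointed cpos (cpos with a least element $\bot$), *strict* if it preserves $\bot$. $\mathbf{CPO}$ is the category of cpos and Scott continuous maps, and $\mathbf{CPO}_{\bot!}$ that of pointed cpos and strict Scott continuous maps, with the smash product $\wedge$. A $\mathbf{CPO}$-category is a category whose hom-sets are cpos and whose composition is Scott continuous; a $\mathbf{CPO}_{\bot!}$-category is one whose hom-cpos are moreover pointed and whose composition is strict in each argument. $\mathbf{CPO}$-functors (resp. $\mathbf{CPO}_{\bot!}$-functors) are functors that are Scott continuous (resp. Scott continuous and strict) on hom-cpos. A $\mathbf{CPO}_{\bot!}$-symmetric monoidal category is a $\mathbf{CPO}_{\bot!}$-category with a symmetric monoidal structure whose $\otimes$ is, on hom-cpos, Scott continuous and strict in each argument. A morphism $e:A\to B$ of a $\mathbf{CPO}$-category is an *embedding* if there is $p:B\to A$ with $p\circ e=\mathrm{id}_A$ and $e\circ p\le \mathrm{id}_B$; it is a *pre-embedding* with respect to a functor $F$ if $F(e)$ is an embedding. An object is *e-initial* if it is initial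 and every morphism out of it is an embedding. A *$\mathbf{CPO}$-LNL model* consists of 1. a $\mathbf{CPO}$-symmetric monoidal closed category $(\mathbf L,\otimes,\multimap,I)$ (that is, a symmetric monoidal closed structure on a $\mathbf{CPO}$-category for which $\otimes$ and $\multimap$ are $\mathbf{CPO}$-functors) with finite $\mathbf{CPO}$-coproducts (copairing is an isomorphism of cpos); 2. a $\mathbf{CPO}$-category $\mathbf C$ with finite $\mathbf{CPO}$-products $(\times,1)$ and finite $\mathbf{CPO}$-coproducts; 3. a $\mathbf{CPO}$-symmetric monoidal adjunction $F\dashv G:\mathbf L\to\mathbf C$ ($F,G$ are $\mathbf{CPO}$-functors and symmetric lax monoidal functors, the bijection $\mathbf C(X,GY)\cong\mathbf L(FX,Y)$ is an isomorphism of cpos, and the unit and the counit are monoidal natural transformations); such that $\mathbf L$ has an e-initial object and colimits of all $\omega$-diagrams of embeddings, $\mathbf C$ has colimits of all $\omega$-diagrams of pre-embeddings with respect to $F$, and the product functor $\times:\mathbf C\times\mathbf C\to\mathbf C$ preserves these colimits. **Theorem.** Let $\mathbf M$ be a small $\mathbf{CPO}_{\bot!}$-symmetric monoidal category, and let $\widehat{\mathbf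 M}$ be the category of $\mathbf{CPO}_{\bot!}$-presheaves on $\mathbf M$: its objects are the $\mathbf{CPO}_{\bot!}$-functors $\mathbf M^{\mathrm{op}}\to\mathbf{CPO}_{\bot!}$, its morphisms are the natural transformations, ordered pointwise. Then $\widehat{\mathbf M}$ has a symmetric monoidal structure given by Day convolution: $T\otimes S$ is the $\mathbf{CPO}_{\bot!}$-enriched left Kan extension of $(a,b)\mapsto T(a)\wedge S(b)$ along the tensor product of $\mathbf M$, the unit $I$ is represented by the unit of $\mathbf M$, and the coherence isomorphisms are induced by those of $\mathbf M$. For every such Day convolution structure, the composite adjunction $$\mathbf{CPO}\;\underset{U}{\overset{(-)_\bot}{\rightleftarrows}}\;\mathbf{CPO}_{\bot!}\;\underset{\widehat{\mathbf M}(I,-)}{\overset{-\odot I}{\rightleftarrows}}\;\widehat{\mathbf M}$$ is a $\mathbf{CPO}$-LNL model with $\mathbf C=\mathbf{CPO}$ and $\mathbf L=\widehat{\mathbf M}$. Here $(-)_\bot$ is lifting, $U$ is the forgetful functor, and $-\odot I$ is the $\mathbf{CPO}_{\bot!}$-copower with $I$, $(A\odot I)(m)=A\wedge I(m)$. The symmetric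 monoidal structure of the adjunction can be chosen such that the right adjoint $G=\widehat{\mathbf M}(I,-)$ carries its standard lax structure, $*\mapsto\mathrm{id}_I$ and $(f,g)\mapsto (f\otimes g)\circ\lambda_I^{-1}$. -/

import Mathlib

open CategoryTheory MonoidalCategory Opposite Limits OmegaCompletePartialOrder

universe u v₁ v₂ u₁ u₂

noncomputable section

namespace CpoLNL

/-! ### Enriched categories, functors and structure

Cpos are Mathlib's ω-complete partial orders, Scott continuity is `ωScottContinuous`
(monotone and preserving suprema of increasing sequences). -/

/-- A `CPO`-category: hom-sets are cpos and composition is Scott continuous. -/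
class CpoCategory (C : Type u₁) [Category.{v₁} C] where
  homCpo : ∀ X Y : C, OmegaCompletePartialOrder (X ⟶ Y)
  comp_continuous : ∀ X Y Z : C,
    ωScottContinuous (fun p : (X ⟶ Y) × (Y ⟶ Z) => p.1 ≫ p.2)

attribute [reducible, instance] CpoCategory.homCpo

/-- A `CPO⊥!`-category (enriched over pointed cpos and strict maps with the smash product):
hom-cpos are moreover pointed and composition is strict in each argument. -/
class CpoBotCategory (C : Type u₁) [Category.{v₁} C] extends CpoCategory C where
  homBot : ∀ X Y : C, OrderBot (X ⟶ Y)
  bot_comp : ∀ {X Y Z : C} (g : Y ⟶ Z), (⊥ : X ⟶ Y) ≫ g = ⊥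
  comp_bot : ∀ {X Y Z : C} (f : X ⟶ Y), f ≫ (⊥ : Y ⟶ Z) = ⊥

attribute [reducible, instance] CpoBotCategory.homBot

/-- A `CPO`-functor: the action on hom-cpos is Scott continuous. -/
def IsCpoFunctor {C : Type u₁} [Category.{v₁} C] [CpoCategory C]
    {D : Type u₂} [Category.{v₂} D] [CpoCategory D] (F : C ⥤ D) : Prop :=
  ∀ X Y : C, ωScottContinuous (fun f : X ⟶ Y => F.map f)

/-- The tensor product is a `CPO`-functor in two variables. -/
def IsCpoTensor (C : Type u₁) [Category.{v₁} C] [MonoidalCategory C] [CpoCategory C] : Prop :=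
  ∀ X X' Y Y' : C, ωScottContinuous (fun p : (X ⟶ X') × (Y ⟶ Y') => p.1 ⊗ₘ p.2)

/-- The compatibility making a (symmetric) monoidal structure on a `CPO⊥!`-category into a
`CPO⊥!`-(symmetric) monoidal category: `⊗` is Scott continuous, and strict in each argument. -/
class CpoBotMonoidal (C : Type u₁) [Category.{v₁} C] [MonoidalCategory C]
    [CpoBotCategory C] : Prop where
  tensor_continuous : IsCpoTensor C
  bot_tensor : ∀ {X X' Y Y' : C} (g : Y ⟶ Y'), (⊥ : X ⟶ X') ⊗ₘ g = ⊥
  tensor_bot : ∀ {X X' Y Y' : C} (f : X ⟶ X'), f ⊗ₘ (⊥ : Y ⟶ Y') = ⊥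

/-- An embedding: a morphism `e` with a projection `p`, `p ∘ e = id` and `e ∘ p ≤ id`. -/
def IsEmbedding {C : Type u₁} [Category.{v₁} C] [CpoCategory C] {X Y : C} (e : X ⟶ Y) : Prop :=
  ∃ p : Y ⟶ X, e ≫ p = 𝟙 X ∧ p ≫ e ≤ 𝟙 Y

/-- A pre-embedding with respect to `F`. -/
def IsPreEmbedding {C : Type u₁} [Category.{v₁} C] {D : Type u₂} [Category.{v₂} D]
    [CpoCategory D] (F : C ⥤ D) {X Y : C} (e : X ⟶ Y) : Prop :=
  IsEmbedding (F.map e)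

/-- An e-initial object: initial, and all morphisms out of it are embeddings. -/
def IsEInitial {C : Type u₁} [Category.{v₁} C] [CpoCategory C] (Z : C) : Prop :=
  Nonempty (IsInitial Z) ∧ ∀ (X : C) (f : Z ⟶ X), IsEmbedding f

/-- `CPO`-enriched binary coproducts: copairing `C(X, Z) × C(Y, Z) ≅ C(X ⨿ Y, Z)` is an isomorphism
of cpos (its inverse is always continuous). -/
def IsCpoCoproducts (C : Type u₁) [Category.{v₁} C] [CpoCategory C]
    [HasFiniteCoproducts C] : Prop :=
  ∀ X Y Z : C, ωScottContinuous (fun p : (X ⟶ Z) × (Y ⟶ Z) => coprod.desc p.1 p.2)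

/-- `CPO`-enriched binary products: pairing `C(Z, X) × C(Z, Y) ≅ C(Z, X × Y)` is an isomorphism
of cpos (its inverse is always continuous). -/
def IsCpoProducts (C : Type u₁) [Category.{v₁} C] [CpoCategory C]
    [CartesianMonoidalCategory C] : Prop :=
  ∀ X Y Z : C, ωScottContinuous
    (fun p : (Z ⟶ X) × (Z ⟶ Y) => CartesianMonoidalCategory.lift p.1 p.2)

/-- The internal hom is a `CPO`-functor, contravariant in its first and covariant in its second
variable. -/
def IsCpoInternalHom (C : Type u₁) [Category.{v₁} C] [CpoCategory C] [MonoidalCategory C]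
    [MonoidalClosed C] : Prop :=
  ∀ X X' Y Y' : C, ωScottContinuous (fun p : (X' ⟶ X) × (Y ⟶ Y') =>
    (MonoidalClosed.pre p.1).app Y ≫ (ihom X').map p.2)

/-- The structure of a `CPO`-LNL model on an adjunction `F ⊣ G : L ⥤ C` between a cartesian monoidal
`CPO`-category `C` and a symmetric monoidal `CPO`-category `L`. -/
structure CpoLNLModel {C : Type u₁} [Category.{v₁} C] [CpoCategory C]
    [CartesianMonoidalCategory C] [BraidedCategory C]
    {L : Type u₂} [Category.{v₂} L] [CpoCategory L]
    [MonoidalCategory L] [SymmetricCategory L]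
    {F : C ⥤ L} {G : L ⥤ C} (adj : F ⊣ G) where
  /-- `L` is `CPO`-symmetric monoidal closed. -/
  closed : MonoidalClosed L
  cpoTensor_L : IsCpoTensor L
  cpoHom_L : IsCpoInternalHom L
  /-- `L` has finite `CPO`-coproducts. -/
  hasFiniteCoproducts_L : HasFiniteCoproducts L
  cpoCoproducts_L : IsCpoCoproducts L
  /-- `C` is `CPO`-cartesian monoidal. -/
  cpoTensor_C : IsCpoTensor C
  cpoProducts_C : IsCpoProducts C
  /-- `C` has finite `CPO`-coproducts. -/
  hasFiniteCoproducts_C : HasFiniteCoproducts C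
  cpoCoproducts_C : IsCpoCoproducts C
  /-- `F ⊣ G` is a `CPO`-adjunction. -/
  cpoFunctor_F : IsCpoFunctor F
  cpoFunctor_G : IsCpoFunctor G
  homEquiv_continuous : ∀ (X : C) (Y : L), ωScottContinuous (adj.homEquiv X Y)
  homEquiv_symm_continuous : ∀ (X : C) (Y : L), ωScottContinuous (adj.homEquiv X Y).symm
  /-- `F ⊣ G` is a symmetric monoidal adjunction: `F` and `G` are symmetric (lax) monoidal functors
  and the unit and counit are monoidal natural transformations. -/
  laxBraided_F : F.LaxBraided
  laxBraided_G : G.LaxBraided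
  isMonoidal_unit : NatTrans.IsMonoidal adj.unit
  isMonoidal_counit : NatTrans.IsMonoidal adj.counit
  /-- `L` has an e-initial object and all ω-colimits over embeddings. -/
  exists_eInitial : ∃ Z : L, IsEInitial Z
  hasColimit_embeddings : ∀ D : ℕ ⥤ L,
    (∀ {i j : ℕ} (h : i ⟶ j), IsEmbedding (D.map h)) → HasColimit D
  /-- `C` has all ω-colimits over pre-embeddings with respect to `F`, and the product functor
  `C × C ⥤ C` preserves them. -/
  hasColimit_preEmbeddings : ∀ D : ℕ ⥤ C,
    (∀ {i j : ℕ} (h : i ⟶ j), IsPreEmbedding F (D.map h)) → HasColimit D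
  preservesColimit_product : ∀ D₁ D₂ : ℕ ⥤ C,
    (∀ {i j : ℕ} (h : i ⟶ j), IsPreEmbedding F (D₁.map h)) →
    (∀ {i j : ℕ} (h : i ⟶ j), IsPreEmbedding F (D₂.map h)) →
    PreservesColimit (D₁.prod' D₂) (MonoidalCategory.tensor C)

/-! ### Auxiliary facts on continuity -/

lemma continuous_of {α β : Type*} [OmegaCompletePartialOrder α] [OmegaCompletePartialOrder β]
    {f : α → β} (hm : Monotone f)
    (h : ∀ (c : Chain α) (x : β), (∀ i, f (c i) ≤ x) → f (ωSup c) ≤ x) :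
    ωScottContinuous f :=
  ωScottContinuous.of_monotone_map_ωSup ⟨hm, fun c => le_antisymm
    (h c _ fun i => le_ωSup (c.map ⟨f, hm⟩) i)
    (ωSup_le _ _ fun i => hm (le_ωSup c i))⟩

lemma apply_ωSup_le {α β : Type*} [OmegaCompletePartialOrder α] [OmegaCompletePartialOrder β]
    {f : α → β} (hf : ωScottContinuous f) (c : Chain α) (x : β) (h : ∀ i, f (c i) ≤ x) :
    f (ωSup c) ≤ x := by
  rw [hf.map_ωSup]
  exact ωSup_le _ _ h

/-! ### The category `CPO` of cpos and Scott continuous functions -/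

instance : CpoCategory ωCPO.{u} where
  homCpo X Y := inferInstanceAs (OmegaCompletePartialOrder (X →𝒄 Y))
  comp_continuous X Y Z := by
    refine continuous_of (α := (X →𝒄 Y) × (Y →𝒄 Z)) (β := X →𝒄 Z)
      (fun p q h x => (p.2.monotone (h.1 x)).trans (h.2 _)) (fun c φ h x => ?_)
    have hc : ωScottContinuous (fun p : (X →𝒄 Y) × (Y →𝒄 Z) => p.2 (p.1 x)) := by fun_prop
    exact apply_ωSup_le hc c (φ x) fun i => h i x

/-- The cartesian structure on `CPO` given by the one-point cpo and the product cpos. -/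
instance : CartesianMonoidalCategory ωCPO.{u} :=
  CartesianMonoidalCategory.ofChosenFiniteProducts
    { cone := asEmptyCone (ωCPO.of PUnit.{u + 1})
      isLimit := IsTerminal.ofUniqueHom
        (fun _ => ContinuousHom.const PUnit.unit) (fun _ _ => rfl) }
    (fun X Y =>
      { cone := BinaryFan.mk (P := ωCPO.of (X × Y))
          (ContinuousHom.ofFun (fun p : X × Y => p.1))
          (ContinuousHom.ofFun (fun p : X × Y => p.2))
        isLimit := BinaryFan.isLimitMk
          (fun s => ContinuousHom.ofFun (α := s.pt) (β := X × Y)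
            (fun x => (ConcreteCategory.hom s.fst x, ConcreteCategory.hom s.snd x))
            (continuous_of (fun _ _ h => ⟨s.fst.monotone h, s.snd.monotone h⟩) fun c x h =>
              ⟨apply_ωSup_le s.fst.ωScottContinuous c x.1 fun i => (h i).1,
                apply_ωSup_le s.snd.ωScottContinuous c x.2 fun i => (h i).2⟩))
          (fun _ => rfl) (fun _ => rfl)
          (fun s m h₁ h₂ => by
            refine ContinuousHom.ext _ _ fun x => Prod.ext ?_ ?_
            · exact ContinuousHom.congr_fun h₁ x
            · exact ContinuousHom.congr_fun h₂ x) })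

instance : BraidedCategory ωCPO.{u} := BraidedCategory.ofCartesianMonoidalCategory

/-! ### The category `CPO⊥!` of pointed cpos and strict Scott continuous functions -/

/-- Pointed cpos. -/
structure PCPO : Type (u + 1) where
  carrier : Type u
  [cpo : OmegaCompletePartialOrder carrier]
  [bot : OrderBot carrier]

attribute [instance] PCPO.cpo PCPO.bot

instance : CoeSort PCPO.{u} (Type u) := ⟨PCPO.carrier⟩

/-- Morphisms of `CPO⊥!`: strict Scott continuous functions. -/
abbrev StrictHom (A B : PCPO.{u}) : Type u := {f : A →𝒄 B // f ⊥ = ⊥}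

instance : LargeCategory PCPO.{u} where
  Hom A B := StrictHom A B
  id A := ⟨ContinuousHom.id, rfl⟩
  comp f g := ⟨g.1.comp f.1, (congrArg g.1 f.2).trans g.2⟩

lemma ωSup_eq_bot {α : Type*} [OmegaCompletePartialOrder α] [OrderBot α] (c : Chain α) :
    ωSup c = ⊥ ↔ ∀ i, c i = ⊥ :=
  ⟨fun h i => le_bot_iff.1 (h ▸ le_ωSup c i),
    fun h => le_bot_iff.1 (ωSup_le _ _ fun i => (h i).le)⟩

instance (A B : PCPO.{u}) : OmegaCompletePartialOrder (StrictHom A B) :=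
  OmegaCompletePartialOrder.subtype (fun f : A →𝒄 B => f ⊥ = ⊥) fun _ hc =>
    le_bot_iff.1 (ωSup_le _ _ fun i => (hc _ ⟨i, rfl⟩).le)

instance (A B : PCPO.{u}) : OrderBot (StrictHom A B) where
  bot := ⟨ContinuousHom.const ⊥, rfl⟩
  bot_le _ _ := bot_le

instance : CpoBotCategory PCPO.{u} where
  homCpo A B := inferInstanceAs (OmegaCompletePartialOrder (StrictHom A B))
  homBot A B := inferInstanceAs (OrderBot (StrictHom A B))
  comp_continuous A B C := by
    refine continuous_of (α := StrictHom A B × StrictHom B C) (β := StrictHom A C)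
      (fun p q h x => (p.2.1.monotone (h.1 x)).trans (h.2 _)) (fun c φ h x => ?_)
    have hv : ∀ A B : PCPO.{u}, ωScottContinuous (fun f : StrictHom A B => f.1) := fun A B =>
      continuous_of (fun _ _ h => h) fun c x h => ωSup_le _ _ h
    have h₁ : ωScottContinuous (fun p : StrictHom A B × StrictHom B C => p.1.1) :=
      (hv A B).comp (by fun_prop)
    have h₂ : ωScottContinuous (fun p : StrictHom A B × StrictHom B C => p.2.1) :=
      (hv B C).comp (by fun_prop)
    have hc : ωScottContinuous
        (fun p : StrictHom A B × StrictHom B C => p.2.1 (p.1.1 x)) := by fun_prop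
    exact apply_ωSup_le hc c (φ.1 x) fun i => h i x
  bot_comp g := Subtype.ext (ContinuousHom.ext _ _ fun _ => g.2)
  comp_bot _ := rfl

/-! ### The lifting adjunction `CPO ⇄ CPO⊥!` -/

section Lifting

variable {X : Type u} [OmegaCompletePartialOrder X]

lemma exists_isLUB_withBot (c : Chain (WithBot X)) : ∃ s, IsLUB (Set.range c) s := by
  classical
  by_cases h : ∀ i, c i = ⊥
  · refine ⟨⊥, ?_, fun _ _ => bot_le⟩
    rintro _ ⟨i, rfl⟩
    exact (h i).le
  · push Not at h
    obtain ⟨n, hn⟩ := h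
    have hne : ∀ i, c (n + i) ≠ ⊥ := fun i =>
      ne_bot_of_le_ne_bot hn (OrderHomClass.mono c (Nat.le_add_right n i))
    let d : Chain X :=
      { toFun := fun i => (c (n + i)).unbot (hne i)
        monotone' := fun i j hij => by
          rw [← WithBot.coe_le_coe, WithBot.coe_unbot, WithBot.coe_unbot]
          exact OrderHomClass.mono c (Nat.add_le_add_left hij n) }
    have hd : ∀ i, (d i : WithBot X) = c (n + i) := fun i => WithBot.coe_unbot _ _
    refine ⟨(ωSup d : X), ?_, fun x hx => ?_⟩
    · rintro _ ⟨i, rfl⟩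
      refine (OrderHomClass.mono c (Nat.le_add_left i n)).trans ?_
      rw [← hd]
      exact WithBot.coe_le_coe.2 (le_ωSup d i)
    · have hx' : ∀ i, (d i : WithBot X) ≤ x := fun i => (hd i).le.trans (hx ⟨_, rfl⟩)
      induction x with
      | bot => exact absurd (hx' 0) (by simp)
      | coe x => exact WithBot.coe_le_coe.2 (ωSup_le _ _ fun i => WithBot.coe_le_coe.1 (hx' i))

/-- The lifting of a cpo: a new least element is adjoined. -/
instance : OmegaCompletePartialOrder (WithBot X) where
  ωSup c := (exists_isLUB_withBot c).choose
  le_ωSup c i := (exists_isLUB_withBot c).choose_spec.1 ⟨i, rfl⟩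
  ωSup_le c x h := (exists_isLUB_withBot c).choose_spec.2 (by rintro _ ⟨i, rfl⟩; exact h i)

lemma withBot_continuous {A : Type u} [OmegaCompletePartialOrder A] [OrderBot A] (f : X →𝒄 A) :
    ωScottContinuous (fun x : WithBot X => WithBot.recBotCoe (C := fun _ => A) ⊥ f x) := by
  have hm : Monotone (fun x : WithBot X => WithBot.recBotCoe (C := fun _ => A) ⊥ f x) := by
    intro x y h
    induction x with
    | bot => exact bot_le
    | coe x =>
      induction y with
      | bot => exact absurd h (by simp)
      | coe y => exact f.monotone (WithBot.coe_le_coe.1 h)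
  refine continuous_of hm fun c z h => ?_
  by_cases hb : ∀ i, c i = ⊥
  · rw [(ωSup_eq_bot c).2 hb]
    exact bot_le
  · push Not at hb
    obtain ⟨n, hn⟩ := hb
    have hne : ∀ i, c (n + i) ≠ ⊥ := fun i =>
      ne_bot_of_le_ne_bot hn (OrderHomClass.mono c (Nat.le_add_right n i))
    let d : Chain X :=
      { toFun := fun i => (c (n + i)).unbot (hne i)
        monotone' := fun i j hij => by
          rw [← WithBot.coe_le_coe, WithBot.coe_unbot, WithBot.coe_unbot]
          exact OrderHomClass.mono c (Nat.add_le_add_left hij n) }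
    have hd : ∀ i, (d i : WithBot X) = c (n + i) := fun i => WithBot.coe_unbot _ _
    have hc : ωSup c ≤ ((ωSup d : X) : WithBot X) := by
      refine ωSup_le _ _ fun i => (OrderHomClass.mono c (Nat.le_add_left i n)).trans ?_
      rw [← hd]
      exact WithBot.coe_le_coe.2 (le_ωSup d i)
    refine (hm hc).trans (apply_ωSup_le f.ωScottContinuous d z fun i => ?_)
    have := h (n + i)
    rw [← hd] at this
    exact this

lemma coe_continuous : ωScottContinuous (fun x : X => (x : WithBot X)) := by
  refine continuous_of (fun _ _ h => WithBot.coe_le_coe.2 h) fun c z h => ?_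
  induction z with
  | bot => exact absurd (h 0) (by simp)
  | coe z => exact WithBot.coe_le_coe.2 (ωSup_le _ _ fun i => WithBot.coe_le_coe.1 (h i))

end Lifting

/-- The strict extension of a Scott continuous function to the lifting. -/
def liftDesc {X : ωCPO.{u}} {A : PCPO.{u}} (f : X →𝒄 A) : PCPO.mk (WithBot X) ⟶ A :=
  ⟨ContinuousHom.ofFun _ (withBot_continuous f), rfl⟩

/-- The inclusion of a cpo into its lifting. -/
def liftUnit (X : ωCPO.{u}) : X →𝒄 WithBot X := ContinuousHom.ofFun _ coe_continuous

lemma lift_hom_ext {X : ωCPO.{u}} {A : PCPO.{u}} {f g : PCPO.mk (WithBot X) ⟶ A}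
    (h : ∀ x : X, f.1 (x : WithBot X) = g.1 (x : WithBot X)) : f = g := by
  refine Subtype.ext (ContinuousHom.ext _ _ fun x => ?_)
  induction (show WithBot X from x) with
  | bot => exact f.2.trans g.2.symm
  | coe x => exact h x

/-- The lifting functor `CPO ⥤ CPO⊥!`. -/
def lifting : ωCPO.{u} ⥤ PCPO.{u} where
  obj X := PCPO.mk (WithBot X)
  map {_ Y} f := liftDesc (A := PCPO.mk (WithBot Y)) ((liftUnit Y).comp f)
  map_id _ := lift_hom_ext fun _ => rfl
  map_comp {_ _ Z} _ _ := lift_hom_ext (A := PCPO.mk (WithBot Z)) fun _ => rfl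

/-- The forgetful functor `CPO⊥! ⥤ CPO`. -/
def forgetful : PCPO.{u} ⥤ ωCPO.{u} where
  obj A := ωCPO.of A
  map f := f.1

/-- Lifting is left adjoint to the forgetful functor. -/
def liftingAdj : lifting.{u} ⊣ forgetful.{u} :=
  Adjunction.mkOfHomEquiv
    { homEquiv := fun X A =>
        { toFun := fun f => ContinuousHom.comp (β := WithBot X) f.1 (liftUnit X)
          invFun := fun g => liftDesc (A := A) g
          left_inv := fun _ => lift_hom_ext fun _ => rfl
          right_inv := fun _ => rfl }
      homEquiv_naturality_left_symm := fun {_ _ A} _ _ => lift_hom_ext (A := A) fun _ => rfl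
      homEquiv_naturality_right := fun _ _ => rfl }

/-! ### Smash products -/

section Smash

variable (A B : Type u) [OmegaCompletePartialOrder A] [OrderBot A]
  [OmegaCompletePartialOrder B] [OrderBot B]

/-- The smash product of two pointed cpos: the pairs which are either `(⊥, ⊥)` or have both
components different from `⊥`, ordered componentwise. -/
abbrev Smash : Type u := {p : A × B // p.1 = ⊥ ↔ p.2 = ⊥}

instance : OmegaCompletePartialOrder (Smash A B) :=
  OmegaCompletePartialOrder.subtype (fun p : A × B => p.1 = ⊥ ↔ p.2 = ⊥) fun c hc => by
    have h₁ := ωSup_eq_bot (c.map (⟨Prod.fst, fun _ _ h => h.1⟩ : A × B →o A))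
    have h₂ := ωSup_eq_bot (c.map (⟨Prod.snd, fun _ _ h => h.2⟩ : A × B →o B))
    exact h₁.trans ((forall_congr' fun i => hc (c i) ⟨i, rfl⟩).trans h₂.symm)

instance : OrderBot (Smash A B) where
  bot := ⟨(⊥, ⊥), ⟨fun _ => rfl, fun _ => rfl⟩⟩
  bot_le _ := ⟨bot_le, bot_le⟩

variable {A B}

open Classical in
/-- The class of a pair in the smash product; it is `⊥` if one of the components is. -/
def smashMk (a : A) (b : B) : Smash A B :=
  if h : a ≠ ⊥ ∧ b ≠ ⊥ then ⟨(a, b), ⟨fun h' => absurd h' h.1, fun h' => absurd h' h.2⟩⟩ else ⊥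

lemma smashMk_of_ne {a : A} {b : B} (ha : a ≠ ⊥) (hb : b ≠ ⊥) :
    (smashMk a b).1 = (a, b) := by
  unfold smashMk
  rw [dif_pos ⟨ha, hb⟩]

lemma smashMk_bot_left (b : B) : smashMk (⊥ : A) b = ⊥ := dif_neg fun h => h.1 rfl

lemma smashMk_bot_right (a : A) : smashMk a (⊥ : B) = ⊥ := dif_neg fun h => h.2 rfl

lemma smashMk_val (p : Smash A B) : smashMk p.1.1 p.1.2 = p := by
  by_cases h : p.1.1 = ⊥
  · rw [h, smashMk_bot_left]
    exact Subtype.ext (Prod.ext (show ⊥ = p.1.1 from h.symm)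
      (show ⊥ = p.1.2 from (p.2.1 h).symm))
  · exact Subtype.ext (smashMk_of_ne h fun h' => h (p.2.2 h'))

lemma smashMk_mono {a a' : A} {b b' : B} (ha : a ≤ a') (hb : b ≤ b') :
    smashMk a b ≤ smashMk a' b' := by
  by_cases h₁ : a = ⊥
  · rw [h₁, smashMk_bot_left]
    exact bot_le
  by_cases h₂ : b = ⊥
  · rw [h₂, smashMk_bot_right]
    exact bot_le
  show (smashMk a b).1 ≤ (smashMk a' b').1
  rw [smashMk_of_ne h₁ h₂, smashMk_of_ne (ne_bot_of_le_ne_bot h₁ ha) (ne_bot_of_le_ne_bot h₂ hb)]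
  exact ⟨ha, hb⟩

lemma smashMk_continuous : ωScottContinuous (fun p : A × B => smashMk p.1 p.2) := by
  refine continuous_of (fun p q h => smashMk_mono h.1 h.2) fun c z h => ?_
  let c₁ : Chain A := c.map ⟨Prod.fst, fun _ _ h => h.1⟩
  let c₂ : Chain B := c.map ⟨Prod.snd, fun _ _ h => h.2⟩
  show smashMk (ωSup c₁) (ωSup c₂) ≤ z
  by_cases h₁ : ωSup c₁ = ⊥
  · rw [h₁, smashMk_bot_left]
    exact bot_le
  by_cases h₂ : ωSup c₂ = ⊥
  · rw [h₂, smashMk_bot_right]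
    exact bot_le
  obtain ⟨m, hm⟩ := not_forall.1 (mt (ωSup_eq_bot c₁).2 h₁)
  obtain ⟨n, hn⟩ := not_forall.1 (mt (ωSup_eq_bot c₂).2 h₂)
  have key : ∀ i, c i ≤ z.1 := fun i => by
    have hi := OrderHomClass.mono c (le_max_left i (max m n))
    have hm' : (c m).1 ≤ (c (max i (max m n))).1 := (OrderHomClass.mono c (by omega)).1
    have hn' : (c n).2 ≤ (c (max i (max m n))).2 := (OrderHomClass.mono c (by omega)).2
    have hz : (smashMk (c (max i (max m n))).1 (c (max i (max m n))).2).1 ≤ z.1 := h _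
    rw [smashMk_of_ne (ne_bot_of_le_ne_bot hm hm') (ne_bot_of_le_ne_bot hn hn')] at hz
    exact hi.trans hz
  show (smashMk (ωSup c₁) (ωSup c₂)).1 ≤ z.1
  rw [smashMk_of_ne h₁ h₂]
  exact ⟨ωSup_le _ _ fun i => (key i).1, ωSup_le _ _ fun i => (key i).2⟩

end Smash

/-- The smash product as a pointed cpo. -/
abbrev smash (A B : PCPO.{u}) : PCPO.{u} := PCPO.mk (Smash A B)

/-- A bistrict Scott continuous function induces a strict function on the smash product. -/
def smashDesc {A B C : PCPO.{u}} (f : A × B → C) (hf : ωScottContinuous f)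
    (hb : f (⊥, ⊥) = ⊥) : smash A B ⟶ C :=
  ⟨ContinuousHom.ofFun (fun p : Smash A B => f p.1)
    (hf.comp (continuous_of (f := fun p : Smash A B => p.1) (fun _ _ h => h)
      fun _ _ h => ⟨ωSup_le _ _ fun i => (h i).1, ωSup_le _ _ fun i => (h i).2⟩)), hb⟩

lemma smash_hom_ext {A B C : PCPO.{u}} {f g : smash A B ⟶ C}
    (h : ∀ (a : A) (b : B), f.1 (smashMk a b) = g.1 (smashMk a b)) : f = g :=
  Subtype.ext (ContinuousHom.ext _ _ fun p =>
    (congrArg f.1 (smashMk_val p)).symm.trans ((h _ _).trans (congrArg g.1 (smashMk_val p))))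

/-- Functoriality of the smash product. -/
def smashMap {A A' B B' : PCPO.{u}} (f : A ⟶ A') (g : B ⟶ B') : smash A B ⟶ smash A' B' :=
  smashDesc (fun p => smashMk (f.1 p.1) (g.1 p.2))
    (smashMk_continuous.comp (f := fun p : A × B => (f.1 p.1, g.1 p.2)) <|
      continuous_of (fun _ _ h => ⟨f.1.monotone h.1, g.1.monotone h.2⟩) fun _ _ h =>
        ⟨apply_ωSup_le f.1.ωScottContinuous _ _ fun i => (h i).1,
          apply_ωSup_le g.1.ωScottContinuous _ _ fun i => (h i).2⟩)
    ((congrArg (fun x => smashMk x (g.1 ⊥)) f.2).trans (smashMk_bot_left _))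

lemma smashDesc_mk {A B C : PCPO.{u}} (f : A × B → C) (hf : ωScottContinuous f)
    (hl : ∀ b, f (⊥, b) = ⊥) (hr : ∀ a, f (a, ⊥) = ⊥) (a : A) (b : B) :
    (smashDesc f hf (hl ⊥)).1 (smashMk a b) = f (a, b) := by
  show f (smashMk a b).1 = f (a, b)
  by_cases ha : a = ⊥
  · rw [ha, smashMk_bot_left, hl]
    exact hl ⊥
  by_cases hb : b = ⊥
  · rw [hb, smashMk_bot_right, hr]
    exact hl ⊥
  rw [smashMk_of_ne ha hb]

lemma smashMap_mk {A A' B B' : PCPO.{u}} (f : A ⟶ A') (g : B ⟶ B') (a : A) (b : B) :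
    (smashMap f g).1 (smashMk a b) = smashMk (f.1 a) (g.1 b) :=
  smashDesc_mk (C := smash A' B') (fun p => smashMk (f.1 p.1) (g.1 p.2)) _
    (fun _ => (congrArg (fun x => smashMk x _) f.2).trans (smashMk_bot_left _))
    (fun _ => (congrArg (fun x => smashMk _ x) g.2).trans (smashMk_bot_right _)) a b

lemma smashMap_id (A B : PCPO.{u}) : smashMap (𝟙 A) (𝟙 B) = 𝟙 (smash A B) :=
  smash_hom_ext fun a b => smashMap_mk (𝟙 A) (𝟙 B) a b

lemma smashMap_comp {A A' A'' B B' B'' : PCPO.{u}} (f : A ⟶ A') (f' : A' ⟶ A'')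
    (g : B ⟶ B') (g' : B' ⟶ B'') :
    smashMap f g ≫ smashMap f' g' = smashMap (f ≫ f') (g ≫ g') :=
  smash_hom_ext fun a b =>
    ((congrArg (smashMap f' g').1 (smashMap_mk f g a b)).trans
      (smashMap_mk f' g' (f.1 a) (g.1 b))).trans (smashMap_mk (f ≫ f') (g ≫ g') a b).symm

/-! ### `CPO⊥!`-presheaves -/

section Presheaves

variable (M : Type u) [SmallCategory M] [CpoBotCategory M]

/-- A `CPO⊥!`-presheaf on `M`: a `CPO⊥!`-functor `Mᵒᵖ ⥤ CPO⊥!`, that is, a functor whose action on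
hom-cpos is Scott continuous and strict. -/
structure Psh where
  functor : Mᵒᵖ ⥤ PCPO.{u}
  map_continuous : ∀ a b : M, ωScottContinuous (fun f : a ⟶ b => functor.map f.op)
  map_bot : ∀ a b : M, functor.map (⊥ : a ⟶ b).op = ⊥

variable {M}

namespace Psh

/-- Morphisms of presheaves: natural transformations. -/
@[ext]
structure Hom (T S : Psh M) where
  natTrans : T.functor ⟶ S.functor

instance : Category (Psh M) where
  Hom := Hom
  id T := ⟨𝟙 T.functor⟩
  comp f g := ⟨f.natTrans ≫ g.natTrans⟩

/-- The value of a presheaf at an object. -/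
def ev (T : Psh M) (a : M) : PCPO.{u} := T.functor.obj (op a)

/-- The action of a presheaf on a morphism. -/
def res (T : Psh M) {a b : M} (f : a ⟶ b) : T.ev b →𝒄 T.ev a := (T.functor.map f.op).1

/-- The component of a morphism of presheaves. -/
def app {T S : Psh M} (φ : T ⟶ S) (a : M) : T.ev a →𝒄 S.ev a := (φ.natTrans.app (op a)).1

lemma app_bot {T S : Psh M} (φ : T ⟶ S) (a : M) : app φ a ⊥ = ⊥ := (φ.natTrans.app (op a)).2

lemma app_res {T S : Psh M} (φ : T ⟶ S) {a b : M} (f : a ⟶ b) (x : T.ev b) :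
    app φ a (T.res f x) = S.res f (app φ b x) :=
  ContinuousHom.congr_fun (congrArg Subtype.val (φ.natTrans.naturality f.op)) x

lemma hom_ext {T S : Psh M} {φ ψ : T ⟶ S} (h : ∀ a x, app φ a x = app ψ a x) : φ = ψ :=
  Hom.ext (NatTrans.ext (funext fun a =>
    Subtype.ext (ContinuousHom.ext _ _ fun x => h a.unop x)))

/-- Build a morphism of presheaves from its components. -/
def homMk {T S : Psh M} (φ : ∀ a, T.ev a →𝒄 S.ev a) (hb : ∀ a, φ a ⊥ = ⊥)
    (hn : ∀ {a b : M} (f : a ⟶ b) (x : T.ev b), φ a (T.res f x) = S.res f (φ b x)) : T ⟶ S :=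
  ⟨{ app := fun a => ⟨φ a.unop, hb a.unop⟩
     naturality := fun _ _ f =>
      Subtype.ext (ContinuousHom.ext _ _ fun x => hn f.unop x) }⟩

/-- Morphisms of presheaves are ordered pointwise. -/
instance (T S : Psh M) : PartialOrder (T ⟶ S) :=
  PartialOrder.lift (fun φ => fun a => app φ a) fun _ _ h =>
    hom_ext fun a => ContinuousHom.congr_fun (congrFun h a)

/-- Evaluation of morphisms of presheaves is monotone. -/
def appHom (T S : Psh M) (a : M) : (T ⟶ S) →o (T.ev a →𝒄 S.ev a) :=
  ⟨fun φ => app φ a, fun _ _ h => h a⟩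

/-- Suprema of increasing sequences of morphisms of presheaves are computed pointwise. -/
instance (T S : Psh M) : OmegaCompletePartialOrder (T ⟶ S) where
  ωSup c := homMk (fun a => ωSup (c.map (appHom T S a)))
    (fun a => le_bot_iff.1 (ωSup_le _ _ fun i => (app_bot (c i) a).le))
    (fun {a b} f x => le_antisymm
      (ωSup_le _ _ fun i => (app_res (c i) f x).le.trans
        ((S.res f).monotone (le_ωSup (c.map (appHom T S b)) i x)))
      (apply_ωSup_le (S.res f).ωScottContinuous _ _ fun i => (app_res (c i) f x).ge.trans
        (le_ωSup (c.map (appHom T S a)) i (T.res f x))))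
  le_ωSup c i a := le_ωSup (c.map (appHom T S a)) i
  ωSup_le c _ h a := ωSup_le (c.map (appHom T S a)) _ fun i => h i a

instance (T S : Psh M) : OrderBot (T ⟶ S) where
  bot := homMk (fun _ => ContinuousHom.const ⊥) (fun _ => rfl)
    (fun f _ => (S.functor.map f.op).2.symm)
  bot_le _ _ _ := bot_le

lemma appHom_continuous {T S : Psh M} (a : M) :
    ωScottContinuous (fun φ : T ⟶ S => app φ a) :=
  continuous_of (fun _ _ h => h a) fun c z h => ωSup_le (c.map (appHom T S a)) z h

instance : CpoBotCategory (Psh M) where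
  homCpo T S := inferInstance
  homBot T S := inferInstance
  comp_continuous T S R := by
    refine continuous_of (fun p q h a x => ((app p.2 a).monotone (h.1 a x)).trans (h.2 a _))
      (fun c φ h a x => ?_)
    have h₁ : ωScottContinuous (fun p : (T ⟶ S) × (S ⟶ R) => app p.1 a) :=
      (appHom_continuous a).comp (by fun_prop)
    have h₂ : ωScottContinuous (fun p : (T ⟶ S) × (S ⟶ R) => app p.2 a) :=
      (appHom_continuous a).comp (by fun_prop)
    have hc : ωScottContinuous
        (fun p : (T ⟶ S) × (S ⟶ R) => app p.2 a (app p.1 a x)) := by fun_prop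
    exact apply_ωSup_le hc c _ fun i => h i a x
  bot_comp g := hom_ext fun a _ => app_bot g a
  comp_bot _ := rfl

/-- The presheaf represented by an object of `M`. -/
def representable (c : M) : Psh M where
  functor :=
    { obj := fun a => PCPO.mk (a.unop ⟶ c)
      map := fun {a b} f =>
        ⟨ContinuousHom.ofFun (fun g : a.unop ⟶ c => f.unop ≫ g)
          ((CpoCategory.comp_continuous b.unop a.unop c).comp
            (f := fun g : a.unop ⟶ c => (f.unop, g)) (by
              refine continuous_of (fun _ _ h => ⟨le_rfl, h⟩) fun d z h => ⟨(h 0).1, ?_⟩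
              exact ωSup_le _ _ fun i => (h i).2)),
          CpoBotCategory.comp_bot _⟩
      map_id := fun _ => Subtype.ext (ContinuousHom.ext _ _ fun g => Category.id_comp g)
      map_comp := fun f g => Subtype.ext (ContinuousHom.ext _ _ fun h =>
        Category.assoc g.unop f.unop h) }
  map_continuous a b := by
    refine continuous_of (fun f g h x => ?_) (fun d z h x => ?_)
    · exact (CpoCategory.comp_continuous a b c).monotone
        (show ((f, x) : (a ⟶ b) × (b ⟶ c)) ≤ (g, x) from ⟨h, le_rfl⟩)
    · have hc : ωScottContinuous (fun f : a ⟶ b => f ≫ (show b ⟶ c from x)) :=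
        (CpoCategory.comp_continuous a b c).comp (f := fun f : a ⟶ b => (f, x))
          (continuous_of (fun _ _ h => ⟨h, le_rfl⟩) fun d z h =>
            ⟨ωSup_le _ _ fun i => (h i).1, (h 0).2⟩)
      exact apply_ωSup_le hc d _ fun i => h i x
  map_bot _ _ := Subtype.ext (ContinuousHom.ext _ _ fun g => CpoBotCategory.bot_comp g)

/-- The functor `Psh(T, -) : Psh M ⥤ CPO⊥!`. -/
def homFunctor (T : Psh M) : Psh M ⥤ PCPO.{u} where
  obj S := PCPO.mk (T ⟶ S)
  map {S R} f :=
    ⟨ContinuousHom.ofFun (fun g : T ⟶ S => g ≫ f)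
      ((CpoCategory.comp_continuous T S R).comp (f := fun g : T ⟶ S => (g, f))
        (continuous_of (fun _ _ h => ⟨h, le_rfl⟩) fun _ _ h =>
          ⟨ωSup_le _ _ fun i => (h i).1, (h 0).2⟩)),
      CpoBotCategory.bot_comp f⟩
  map_id _ := Subtype.ext (ContinuousHom.ext _ _ fun g => Category.comp_id g)
  map_comp f g := Subtype.ext (ContinuousHom.ext _ _ fun h => (Category.assoc h f g).symm)

/-- The `CPO⊥!`-copower `A ⊙ T`, which is given pointwise by the smash product. -/
def copowerObj (T : Psh M) (A : PCPO.{u}) : Psh M where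
  functor :=
    { obj := fun a => smash A (T.functor.obj a)
      map := fun f => smashMap (𝟙 A) (T.functor.map f)
      map_id := fun a => by rw [T.functor.map_id, smashMap_id]
      map_comp := fun f g => by rw [T.functor.map_comp, smashMap_comp, Category.comp_id] }
  map_continuous a b := by
    have hc : ∀ p : Smash A (T.ev b),
        ωScottContinuous (fun f : a ⟶ b => smashMk p.1.1 (T.res f p.1.2)) := fun p =>
      smashMk_continuous.comp (f := fun f : a ⟶ b => (p.1.1, T.res f p.1.2))
        (continuous_of (fun _ _ h => ⟨le_rfl, (T.map_continuous a b).monotone h p.1.2⟩)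
          fun d z h => ⟨(h 0).1, by
            rw [show T.res (ωSup d) = _ from congrArg Subtype.val
              ((T.map_continuous a b).map_ωSup d)]
            exact ωSup_le _ _ fun i => (h i).2⟩)
    exact continuous_of (fun f g h p => (hc p).monotone h)
      (fun d z h p => apply_ωSup_le (hc p) d _ fun i => h i p)
  map_bot a b := smash_hom_ext fun x y => by
    refine (smashMap_mk _ _ x y).trans ?_
    rw [T.map_bot]
    exact smashMk_bot_right _

/-- The `CPO⊥!`-copower functor `- ⊙ T : CPO⊥! ⥤ Psh M`. -/
def copower (T : Psh M) : PCPO.{u} ⥤ Psh M where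
  obj A := copowerObj T A
  map {A B} f :=
    ⟨{ app := fun a => smashMap f (𝟙 (T.functor.obj a))
       naturality := fun a b g => by
        show smashMap (𝟙 A) (T.functor.map g) ≫ smashMap f (𝟙 _) =
          smashMap f (𝟙 _) ≫ smashMap (𝟙 B) (T.functor.map g)
        rw [smashMap_comp, smashMap_comp, Category.id_comp, Category.comp_id, Category.id_comp,
          Category.comp_id] }⟩
  map_id A := Hom.ext (NatTrans.ext (funext fun a => smashMap_id A (T.functor.obj a)))
  map_comp f g := Hom.ext (NatTrans.ext (funext fun a => by
    show smashMap (f ≫ g) (𝟙 _) = smashMap f (𝟙 _) ≫ smashMap g (𝟙 _)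
    rw [smashMap_comp, Category.comp_id]))

/-- The component of a morphism of presheaves out of a copower. -/
def copowerApp {T S : Psh M} {A : PCPO.{u}} (φ : copowerObj T A ⟶ S) (a : M) :
    smash A (T.ev a) ⟶ S.ev a := φ.natTrans.app (op a)

lemma copower_hom_ext {T S : Psh M} {A : PCPO.{u}} {φ ψ : copowerObj T A ⟶ S}
    (h : ∀ (a : M) (x : A) (y : T.ev a),
      (copowerApp φ a).1 (smashMk x y) = (copowerApp ψ a).1 (smashMk x y)) : φ = ψ :=
  Hom.ext (NatTrans.ext (funext fun a => smash_hom_ext (C := S.functor.obj a)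
    fun x y => h a.unop x y))

lemma copowerApp_res {T S : Psh M} {A : PCPO.{u}} (φ : copowerObj T A ⟶ S) {a b : M} (f : a ⟶ b)
    (x : A) (y : T.ev b) :
    (copowerApp φ a).1 (smashMk x (T.res f y)) = S.res f ((copowerApp φ b).1 (smashMk x y)) :=
  (congrArg (copowerApp φ a).1
    (smashMap_mk (𝟙 A) (T.functor.map f.op) x y).symm).trans (app_res φ f _)

/-- The strict function `A → Psh(T, S)` associated with a morphism `A ⊙ T ⟶ S`. -/
def copowerCurry {T S : Psh M} {A : PCPO.{u}} (φ : copowerObj T A ⟶ S) :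
    A ⟶ (homFunctor T).obj S :=
  ⟨ContinuousHom.ofFun (β := T ⟶ S)
    (fun x => homMk
      (fun a => ContinuousHom.ofFun (fun y => (copowerApp φ a).1 (smashMk x y))
        ((copowerApp φ a).1.ωScottContinuous.comp
          (smashMk_continuous.comp (f := fun y : T.ev a => (x, y))
            (continuous_of (fun _ _ h => ⟨le_rfl, h⟩)
              fun _ _ h => ⟨(h 0).1, ωSup_le _ _ fun i => (h i).2⟩))))
      (fun a => (congrArg (copowerApp φ a).1 (smashMk_bot_right x)).trans (copowerApp φ a).2)
      (fun f y => copowerApp_res φ f x y))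
    (by
      have hc : ∀ (a : M) (y : T.ev a),
          ωScottContinuous (fun x : A => (copowerApp φ a).1 (smashMk x y)) := fun a y =>
        (copowerApp φ a).1.ωScottContinuous.comp
          (smashMk_continuous.comp (f := fun x : A => (x, y))
            (continuous_of (fun _ _ h => ⟨h, le_rfl⟩)
              fun _ _ h => ⟨ωSup_le _ _ fun i => (h i).1, (h 0).2⟩))
      exact continuous_of (fun _ _ h a y => (hc a y).monotone h)
        fun c z h a y => apply_ωSup_le (hc a y) c _ fun i => h i a y),
    hom_ext fun a y =>
      (congrArg (copowerApp φ a).1 (smashMk_bot_left y)).trans (copowerApp φ a).2⟩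

lemma uncurry_continuous {T S : Psh M} {A : PCPO.{u}} (g : A →𝒄 (T ⟶ S)) (a : M) :
    ωScottContinuous (fun p : A × T.ev a => app (g p.1) a p.2) := by
  have h₁ : ωScottContinuous (fun p : A × T.ev a => app (g p.1) a) :=
    (appHom_continuous a).comp (g.ωScottContinuous.comp (by fun_prop))
  fun_prop

/-- The morphism `A ⊙ T ⟶ S` associated with a strict function `A → Psh(T, S)`. -/
def copowerUncurry {T S : Psh M} {A : PCPO.{u}} (g : A →𝒄 (T ⟶ S)) (hg : g ⊥ = ⊥) :
    copowerObj T A ⟶ S :=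
  ⟨{ app := fun a => smashDesc (C := S.ev a.unop) _ (uncurry_continuous g a.unop) (app_bot _ _)
     naturality := fun a b f => smash_hom_ext (C := S.functor.obj b) fun x y => by
      have hm : ∀ (a : M) (y : T.ev a), (smashDesc (C := S.ev a) _ (uncurry_continuous g a)
          (app_bot _ _)).1 (smashMk x y) = app (g x) a y := fun a y =>
        smashDesc_mk (C := S.ev a) _ (uncurry_continuous g a)
          (fun b => (congrArg (fun φ => app φ a b) hg).trans rfl) (fun _ => app_bot _ _) x y
      have hr := congrArg (smashDesc (C := S.ev b.unop) _ (uncurry_continuous g b.unop)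
        (app_bot _ _)).1 (smashMap_mk (𝟙 A) (T.functor.map f) x y)
      exact (hr.trans (hm b.unop _)).trans ((app_res (g x) f.unop y).trans
        (congrArg (S.res f.unop) (hm a.unop y)).symm) }⟩

lemma copowerUncurry_mk {T S : Psh M} {A : PCPO.{u}} (g : A →𝒄 (T ⟶ S)) (hg : g ⊥ = ⊥)
    (a : M) (x : A) (y : T.ev a) :
    (copowerApp (copowerUncurry g hg) a).1 (smashMk x y) = app (g x) a y :=
  smashDesc_mk (C := S.ev a) _ (uncurry_continuous g a)
    (fun b => (congrArg (fun φ => app φ a b) hg).trans rfl) (fun _ => app_bot _ _) x y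

/-- The copower functor `- ⊙ T` is left adjoint to the representable functor `Psh(T, -)`. -/
def copowerAdj (T : Psh M) : copower T ⊣ homFunctor T :=
  Adjunction.mkOfHomEquiv
    { homEquiv := fun _ _ =>
        { toFun := fun φ => copowerCurry φ
          invFun := fun g => copowerUncurry g.1 g.2
          left_inv := fun _ => copower_hom_ext fun a x y => copowerUncurry_mk _ _ a x y
          right_inv := fun g => Subtype.ext (ContinuousHom.ext _ _ fun x =>
            hom_ext fun a y => copowerUncurry_mk g.1 g.2 a x y) }
      homEquiv_naturality_left_symm := fun f g => copower_hom_ext fun a x y =>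
        (copowerUncurry_mk (f ≫ g).1 (f ≫ g).2 a x y).trans ((copowerUncurry_mk g.1 g.2 a (f.1 x) y).symm.trans
          (congrArg (copowerApp (copowerUncurry g.1 g.2) a).1
            (smashMap_mk f (𝟙 (T.ev a)) x y).symm))
      homEquiv_naturality_right := fun _ _ => rfl }

end Psh

/-! ### Day convolution -/

section Day

variable [MonoidalCategory M]

/-- A natural family of bistrict Scott continuous functions `T a × S b → R (a ⊗ b)`, that is, a
`CPO⊥!`-natural family of morphisms `T a ∧ S b ⟶ R (a ⊗ b)` out of the smash product. -/
structure DayBihom (T S R : Psh M) where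
  toFun : ∀ a b : M, T.ev a → S.ev b → R.ev (a ⊗ b)
  continuous : ∀ a b : M, ωScottContinuous (fun p : T.ev a × S.ev b => toFun a b p.1 p.2)
  bot_left : ∀ (a b : M) (y : S.ev b), toFun a b ⊥ y = ⊥
  bot_right : ∀ (a b : M) (x : T.ev a), toFun a b x ⊥ = ⊥
  natural : ∀ {a a' b b' : M} (f : a' ⟶ a) (g : b' ⟶ b) (x : T.ev a) (y : S.ev b),
    toFun a' b' (T.res f x) (S.res g y) = R.res (f ⊗ₘ g) (toFun a b x y)

/-- A symmetric monoidal structure on `Psh M` is (the) Day convolution if `T ⊗ S` is the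
`CPO⊥!`-enriched left Kan extension of the external smash product `T a ∧ S b` along the tensor product
of `M`, equivalently the coend `∫^{a, b} M(-, a ⊗ b) ∧ T a ∧ S b`, the unit is the presheaf
represented by the unit of `M`, and the functoriality of `⊗`, the associator, the unitors and the
braiding are induced from those of `M`.  Such a structure is unique up to unique isomorphism. -/
structure DayConvolution (M : Type u) [SmallCategory M] [CpoBotCategory M] [MonoidalCategory M]
    [SymmetricCategory M] [MonoidalCategory (Psh M)] [SymmetricCategory (Psh M)] where
  /-- The universal natural family `T a ∧ S b ⟶ (T ⊗ S) (a ⊗ b)`. -/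
  bihom : ∀ T S : Psh M, DayBihom T S (T ⊗ S)
  existsUnique_desc : ∀ {T S R : Psh M} (φ : DayBihom T S R), ∃! f : T ⊗ S ⟶ R,
    ∀ (a b : M) (x : T.ev a) (y : S.ev b),
      Psh.app f (a ⊗ b) ((bihom T S).toFun a b x y) = φ.toFun a b x y
  /-- The universal property is one of cpos, not only of sets. -/
  le_of_bihom_le : ∀ {T S R : Psh M} (f g : T ⊗ S ⟶ R),
    (∀ (a b : M) (x : T.ev a) (y : S.ev b),
      Psh.app f (a ⊗ b) ((bihom T S).toFun a b x y) ≤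
        Psh.app g (a ⊗ b) ((bihom T S).toFun a b x y)) → f ≤ g
  unitIso : Psh.representable (𝟙_ M) ≅ 𝟙_ (Psh M)
  tensorHom_bihom : ∀ {T T' S S' : Psh M} (f : T ⟶ T') (g : S ⟶ S') (a b : M)
    (x : T.ev a) (y : S.ev b),
    Psh.app (f ⊗ₘ g) (a ⊗ b) ((bihom T S).toFun a b x y) =
      (bihom T' S').toFun a b (Psh.app f a x) (Psh.app g b y)
  associator_bihom : ∀ (T S R : Psh M) (a b c : M) (x : T.ev a) (y : S.ev b) (z : R.ev c),
    Psh.app (α_ T S R).hom ((a ⊗ b) ⊗ c)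
        ((bihom (T ⊗ S) R).toFun (a ⊗ b) c ((bihom T S).toFun a b x y) z) =
      (T ⊗ (S ⊗ R)).res (α_ a b c).hom
        ((bihom T (S ⊗ R)).toFun a (b ⊗ c) x ((bihom S R).toFun b c y z))
  leftUnitor_bihom : ∀ (T : Psh M) (a b : M) (f : a ⟶ 𝟙_ M) (x : T.ev b),
    Psh.app (λ_ T).hom (a ⊗ b)
        ((bihom (𝟙_ (Psh M)) T).toFun a b (Psh.app unitIso.hom a f) x) =
      T.res (f ▷ b ≫ (λ_ b).hom) x
  rightUnitor_bihom : ∀ (T : Psh M) (a b : M) (x : T.ev a) (f : b ⟶ 𝟙_ M),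
    Psh.app (ρ_ T).hom (a ⊗ b)
        ((bihom T (𝟙_ (Psh M))).toFun a b x (Psh.app unitIso.hom b f)) =
      T.res (a ◁ f ≫ (ρ_ a).hom) x
  braiding_bihom : ∀ (T S : Psh M) (a b : M) (x : T.ev a) (y : S.ev b),
    Psh.app (β_ T S).hom (a ⊗ b) ((bihom T S).toFun a b x y) =
      (S ⊗ T).res (β_ a b).hom ((bihom S T).toFun b a y x)

end Day

section Composite

variable [MonoidalCategory (Psh M)]

/-- The left adjoint `CPO ⥤ CPO⊥! ⥤ Psh M`, `X ↦ X_⊥ ⊙ I`. -/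
abbrev linF (M : Type u) [SmallCategory M] [CpoBotCategory M] [MonoidalCategory (Psh M)] :
    ωCPO.{u} ⥤ Psh M :=
  lifting ⋙ Psh.copower (𝟙_ (Psh M))

/-- The right adjoint `Psh M ⥤ CPO⊥! ⥤ CPO`, `T ↦ Psh(I, T)`. -/
abbrev linG (M : Type u) [SmallCategory M] [CpoBotCategory M] [MonoidalCategory (Psh M)] :
    Psh M ⥤ ωCPO.{u} :=
  Psh.homFunctor (𝟙_ (Psh M)) ⋙ forgetful

/-- The composite adjunction `CPO ⇄ CPO⊥! ⇄ Psh M`. -/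
abbrev compositeAdj (M : Type u) [SmallCategory M] [CpoBotCategory M]
    [MonoidalCategory (Psh M)] : linF M ⊣ linG M :=
  liftingAdj.comp (Psh.copowerAdj (𝟙_ (Psh M)))

/-- The standard monoidal structure on the right adjoint `T ↦ Psh(I, T)`: the point of
`Psh(I, I)` is the identity, and `(f, g)` is sent to `(f ⊗ g) ∘ λ_I⁻¹`. -/
def IsStandardLax (h : (linG M).LaxMonoidal) : Prop :=
  (show PUnit.{u + 1} →𝒄 (𝟙_ (Psh M) ⟶ 𝟙_ (Psh M)) from h.ε) PUnit.unit = 𝟙 _ ∧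
  ∀ (T S : Psh M) (f : 𝟙_ (Psh M) ⟶ T) (g : 𝟙_ (Psh M) ⟶ S),
    (show (𝟙_ (Psh M) ⟶ T) × (𝟙_ (Psh M) ⟶ S) →𝒄 (𝟙_ (Psh M) ⟶ T ⊗ S) from h.μ T S) (f, g) =
      (λ_ (𝟙_ (Psh M))).inv ≫ (f ⊗ₘ g)

end Composite

end Presheaves

end CpoLNL

/-! Colimits of cpos are not computed on underlying sets, and the Day convolution is itself a
colimit, so the basic tool is a construction of cpos from generators and inequalities `p ≤ sup s`.
In `FreeCpo` the elements are sets of generators closed under the relations, but only those reached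
from principal ones by suprema of increasing sequences. This restriction makes the construction
free: a map on generators respecting the relations extends to any cpo, although only suprema of
increasing sequences exist there, and it does so uniquely (`FreeCpo.lift`, `FreeCpo.hom_ext`).
Applied at each object of `M`, with the generators closed under restriction, it presents presheaves
(`Presentation.psh`, `Presentation.desc`). This yields colimits of cpos, nonempty colimits of
presheaves and the Day tensor product. Each universal property also reflects the order
(`FreeCpo.le_of_gen_le`, `Presentation.hom_le`), and this is where the enrichment over cpos comes
from.

Morphisms `T ⊗ S ⟶ Z` are bistrict natural families `T a × S b → Z (a ⊗ b)`, and these are the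
morphisms from `S` to the presheaf `c ↦ Psh(T, Z (- ⊗ c))`. Hence the internal hom, and also the
principle that morphisms out of iterated tensor products are determined by pure tensors. On pure
tensors each coherence law becomes the corresponding law of `M`. For a given Day convolution only
its universal family is used, so the argument applies to every such structure.

For the model itself, the one-point presheaf is e-initial with the zero morphism as projection, and
the product of cpos preserves ω-colimits because `CPO` is cartesian closed and `ℕ` is sifted. For
the adjunction, every element of `X_⊥ ⊙ I` is either `⊥` or lies on a point `I ⟶ X_⊥ ⊙ I` given by
some `x : X`. Morphisms out of `F X` are thus compared on points (`linF_le`), and morphisms out of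
`F X ⊗ F Y` are determined by pairs of points. The standard lax structure on `G` induces an oplax
structure on `F`. Its structure maps are invertible, the inverse of the binary one coming from
closedness (`linFTensor`), so `F` is strong monoidal and the adjunction is monoidal. -/

namespace CpoLNL

/-! ### Cpos presented by generators and relations -/

section FreeCpo

variable {P : Type u} (rel : P → Set P → Prop)

/-- The closure of a set of generators under a relation `rel p s`, read as `p ≤ sup s`. -/
def hull (s : Set P) : Set P :=
  {p | ∀ I : Set P, (∀ q t, rel q t → t ⊆ I → q ∈ I) → s ⊆ I → p ∈ I}

/-- The closed sets obtained from the principal ones by suprema of increasing sequences. -/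
inductive Generated : Set P → Prop
  | gen (p : P) : Generated (hull rel {p})
  | sup (c : ℕ → Set P) (hc : Monotone c) (h : ∀ n, Generated (c n)) :
      Generated (hull rel (⋃ n, c n))

/-- The cpo generated by `P` subject to the relations `rel p s`, read as `p ≤ sup s`. -/
def FreeCpo : Type u := {I : Set P // Generated rel I}

variable {rel}

lemma subset_hull (s : Set P) : s ⊆ hull rel s := fun _ hp _ _ hs => hs hp

lemma hull_closed {s : Set P} {q : P} {t : Set P} (h : rel q t) (ht : t ⊆ hull rel s) :
    q ∈ hull rel s := fun I hI hs => hI q t h fun _ hr => ht hr I hI hs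

lemma Generated.closed {I : Set P} (hI : Generated rel I) {q : P} {t : Set P} (h : rel q t)
    (ht : t ⊆ I) : q ∈ I := by
  cases hI <;> exact hull_closed h ht

lemma Generated.hull_subset {I : Set P} (hI : Generated rel I) {s : Set P} (hs : s ⊆ I) :
    hull rel s ⊆ I := fun _ hp => hp I (fun _ _ h ht => hI.closed h ht) hs

instance : PartialOrder (FreeCpo rel) := inferInstanceAs (PartialOrder {I // Generated rel I})

instance : OmegaCompletePartialOrder (FreeCpo rel) where
  ωSup c := ⟨_, Generated.sup (fun n => (c n).1) (fun _ _ h => OrderHomClass.mono c h)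
    fun n => (c n).2⟩
  le_ωSup c i := (Set.subset_iUnion (fun n => (c n).1) i).trans (subset_hull _)
  ωSup_le _ J h := J.2.hull_subset (Set.iUnion_subset h)

namespace FreeCpo

variable (rel) in
/-- The generators of a presented cpo. -/
def gen (p : P) : FreeCpo rel := ⟨_, Generated.gen p⟩

lemma gen_le_iff {p : P} {I : FreeCpo rel} : gen rel p ≤ I ↔ p ∈ I.1 :=
  ⟨fun h => h (subset_hull _ rfl), fun h => I.2.hull_subset (Set.singleton_subset_iff.2 h)⟩

lemma gen_le_of_rel {p : P} {s : Set P} (h : rel p s) {I : FreeCpo rel}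
    (hs : ∀ q ∈ s, gen rel q ≤ I) : gen rel p ≤ I :=
  gen_le_iff.2 (I.2.closed h fun q hq => gen_le_iff.1 (hs q hq))

-- This is what discarding the closed sets outside `Generated` buys: continuous functions are
-- controlled by their values on generators.
@[elab_as_elim]
lemma induction {motive : FreeCpo rel → Prop} (hgen : ∀ p, motive (gen rel p))
    (hsup : ∀ c : Chain (FreeCpo rel), (∀ n, motive (c n)) → motive (ωSup c))
    (I : FreeCpo rel) : motive I := by
  obtain ⟨I, hI⟩ := I
  induction hI with
  | gen p => exact hgen p
  | sup c hc h ih => exact hsup ⟨⟨fun n => ⟨c n, h n⟩, fun _ _ h => hc h⟩⟩ ih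

variable {X : Type*} [OmegaCompletePartialOrder X]

/-- The elements with `f I ≤ g I` are stable under suprema of chains as soon as the smaller function
preserves them and the larger one is monotone. This ordered form of uniqueness makes the later
universal properties hold for hom-cpos, not just for hom-sets. -/
lemma le_of_gen_le {f g : FreeCpo rel → X} (hf : ωScottContinuous f) (hg : Monotone g)
    (h : ∀ p, f (gen rel p) ≤ g (gen rel p)) (I : FreeCpo rel) : f I ≤ g I := by
  induction I using FreeCpo.induction with
  | hgen p => exact h p
  | hsup c ih => exact apply_ωSup_le hf c _ fun n => (ih n).trans (hg (le_ωSup c n))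

lemma hom_ext {f g : FreeCpo rel →𝒄 X} (h : ∀ p, f (gen rel p) = g (gen rel p)) : f = g :=
  ContinuousHom.ext _ _ fun I => le_antisymm
    (le_of_gen_le f.ωScottContinuous g.monotone (fun p => (h p).le) I)
    (le_of_gen_le g.ωScottContinuous f.monotone (fun p => (h p).ge) I)

variable (rel) in
/-- The functions on the generators which respect the relations. -/
def Respects (f : P → X) : Prop := ∀ p s, rel p s → ∀ u, (∀ q ∈ s, f q ≤ u) → f p ≤ u

variable {f : P → X}

/-- The set `{q | f q ≤ u}` is closed under the relations, which is exactly what `Respects` says. -/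
lemma Respects.le_of_mem_hull (hf : Respects rel f) {s : Set P} {u : X} (hs : ∀ q ∈ s, f q ≤ u)
    {p : P} (hp : p ∈ hull rel s) : f p ≤ u :=
  hp {q | f q ≤ u} (fun q t h ht => hf q t h u ht) hs

/-- An arbitrary closed set need not have a supremum in `X`. A generated one does: `f p` is the
greatest value on the hull of `p`, and at a limit stage the suprema of the stages form a chain whose
supremum still bounds the hull of the union. -/
lemma Respects.exists_isLUB (hf : Respects rel f) (I : FreeCpo rel) :
    ∃ x, IsLUB (f '' I.1) x := by
  obtain ⟨I, hI⟩ := I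
  induction hI with
  | gen p =>
    refine ⟨f p, ?_, fun u hu => hu ⟨p, subset_hull _ rfl, rfl⟩⟩
    rintro _ ⟨q, hq, rfl⟩
    exact hf.le_of_mem_hull (by rintro _ rfl; exact le_rfl) hq
  | sup c hc h ih =>
    choose x hx using ih
    let d : Chain X := ⟨⟨x, fun m n hmn => (hx m).mono (hx n) (Set.image_mono (hc hmn))⟩⟩
    refine ⟨ωSup d, ?_, fun u hu => ωSup_le _ _ fun n => (hx n).2 ?_⟩
    · rintro _ ⟨q, hq, rfl⟩
      refine hf.le_of_mem_hull (fun r hr => ?_) hq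
      obtain ⟨n, hn⟩ := Set.mem_iUnion.1 hr
      exact ((hx n).1 ⟨r, hn, rfl⟩).trans (le_ωSup d n)
    · rintro _ ⟨q, hq, rfl⟩
      exact hu ⟨q, subset_hull _ (Set.mem_iUnion.2 ⟨n, hq⟩), rfl⟩

/-- The continuous extension of a function on the generators. -/
def lift (f : P → X) (hf : Respects rel f) : FreeCpo rel →𝒄 X :=
  ContinuousHom.ofFun (fun I => (hf.exists_isLUB I).choose) <| by
    have hs := fun I => (hf.exists_isLUB I).choose_spec
    -- The supremum of the chain is a hull of a union, and an upper bound on the union persists on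
    -- its hull.
    refine continuous_of (fun I J h => (hs I).mono (hs J) (Set.image_mono h)) fun c u h => ?_
    refine (hs (ωSup c)).2 ?_
    rintro _ ⟨q, hq, rfl⟩
    refine hf.le_of_mem_hull (fun r hr => ?_) hq
    obtain ⟨n, hn⟩ := Set.mem_iUnion.1 hr
    exact ((hs (c n)).1 ⟨r, hn, rfl⟩).trans (h n)

@[simp]
lemma lift_gen (hf : Respects rel f) (p : P) : lift f hf (gen rel p) = f p := by
  have hs := (hf.exists_isLUB (gen rel p)).choose_spec
  refine le_antisymm (hs.2 ?_) (hs.1 ⟨p, subset_hull _ rfl, rfl⟩)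
  rintro _ ⟨q, hq, rfl⟩
  exact hf.le_of_mem_hull (by rintro _ rfl; exact le_rfl) hq

end FreeCpo

end FreeCpo

/-! ### Colimits of cpos -/

section CpoColimits

variable {J : Type} [SmallCategory J] (D : J ⥤ ωCPO.{u})

/-- The relations presenting the colimit of a diagram of cpos. -/
inductive ColimitRel : (Σ j, D.obj j) → Set (Σ j, D.obj j) → Prop
  | mono {j : J} {x y : D.obj j} (h : x ≤ y) : ColimitRel ⟨j, x⟩ {⟨j, y⟩}
  | sup {j : J} (c : Chain (D.obj j)) :
      ColimitRel ⟨j, ωSup c⟩ (Set.range fun n => ⟨j, c n⟩)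
  | le_map {j k : J} (f : j ⟶ k) (x : D.obj j) :
      ColimitRel ⟨j, x⟩ {⟨k, (D.map f : D.obj j →𝒄 D.obj k) x⟩}
  | map_le {j k : J} (f : j ⟶ k) (x : D.obj j) :
      ColimitRel ⟨k, (D.map f : D.obj j →𝒄 D.obj k) x⟩ {⟨j, x⟩}

/-- The colimit cocone of a diagram of cpos. -/
def cpoColimitCocone : Cocone D where
  pt := ωCPO.of (FreeCpo (ColimitRel D))
  ι :=
    { app := fun j => ContinuousHom.ofFun (α := D.obj j) (β := FreeCpo (ColimitRel D))
        (fun x => FreeCpo.gen (ColimitRel D) ⟨j, x⟩)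
        (continuous_of
          (fun x y h => FreeCpo.gen_le_of_rel (.mono h) (by rintro _ rfl; exact le_rfl))
          (fun c x h => FreeCpo.gen_le_of_rel (.sup c) (by rintro _ ⟨n, rfl⟩; exact h n)))
      naturality := fun j k f => ContinuousHom.ext _ _ fun x => le_antisymm
        (FreeCpo.gen_le_of_rel (.map_le f x) (by rintro _ rfl; exact le_rfl))
        (FreeCpo.gen_le_of_rel (.le_map f x) (by rintro _ rfl; exact le_rfl)) }

lemma cpoColimit_respects (s : Cocone D) :
    FreeCpo.Respects (X := s.pt) (ColimitRel D)
      (fun p : Σ j, D.obj j => (s.ι.app p.1 : D.obj p.1 →𝒄 s.pt) p.2) := by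
  intro p t h u hu
  cases h with
  | mono h => exact ((s.ι.app _ : _ →𝒄 s.pt).monotone h).trans (hu _ rfl)
  | sup c => exact apply_ωSup_le (s.ι.app _ : _ →𝒄 s.pt).ωScottContinuous c u fun n => hu _ ⟨n, rfl⟩
  | le_map f x => exact (ContinuousHom.congr_fun (s.w f) x).ge.trans (hu _ rfl)
  | map_le f x => exact (ContinuousHom.congr_fun (s.w f) x).le.trans (hu _ rfl)

/-- The universal property of the colimit of a diagram of cpos. -/
def cpoColimitIsColimit : IsColimit (cpoColimitCocone D) where
  desc s := FreeCpo.lift _ (cpoColimit_respects D s)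
  fac s j := ContinuousHom.ext _ _ fun x => FreeCpo.lift_gen (cpoColimit_respects D s) ⟨j, x⟩
  uniq s _ h := FreeCpo.hom_ext (X := s.pt) fun p =>
    (ContinuousHom.congr_fun (h p.1) p.2).trans
      (FreeCpo.lift_gen (cpoColimit_respects D s) p).symm

instance : HasColimitsOfSize.{0, 0} ωCPO.{u} where
  has_colimits_of_shape _ _ := { has_colimit := fun D => ⟨_, cpoColimitIsColimit D⟩ }

end CpoColimits

/-! ### Order-reflecting colimits and enriched coproducts -/

/-- A colimit cocone in a `CPO`-category with a universal property of cpos. -/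
def IsCpoColimit {C : Type u₁} [Category.{v₁} C] [CpoCategory C] {J : Type} [SmallCategory J]
    {D : J ⥤ C} (s : Cocone D) : Prop :=
  ∀ ⦃Z : C⦄ (f g : s.pt ⟶ Z), (∀ j, s.ι.app j ≫ f ≤ s.ι.app j ≫ g) → f ≤ g

lemma comp_le_comp {C : Type u₁} [Category.{v₁} C] [CpoCategory C] {X Y Z : C} {f f' : X ⟶ Y}
    {g g' : Y ⟶ Z} (hf : f ≤ f') (hg : g ≤ g') : f ≫ g ≤ f' ≫ g' :=
  (CpoCategory.comp_continuous X Y Z).monotone (show (f, g) ≤ (f', g') from ⟨hf, hg⟩)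

lemma prodMk_left_continuous {α β : Type*} [OmegaCompletePartialOrder α]
    [OmegaCompletePartialOrder β] (a : α) : ωScottContinuous (fun b : β => (a, b)) :=
  continuous_of (fun _ _ h => ⟨le_rfl, h⟩) fun _ _ h => ⟨(h 0).1, ωSup_le _ _ fun i => (h i).2⟩

lemma prodMk_right_continuous {α β : Type*} [OmegaCompletePartialOrder α]
    [OmegaCompletePartialOrder β] (b : β) : ωScottContinuous (fun a : α => (a, b)) :=
  continuous_of (fun _ _ h => ⟨h, le_rfl⟩) fun _ _ h => ⟨ωSup_le _ _ fun i => (h i).1, (h 0).2⟩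

lemma comp_left_continuous {C : Type u₁} [Category.{v₁} C] [CpoCategory C] {X Y : C} (Z : C)
    (f : X ⟶ Y) : ωScottContinuous (fun g : Y ⟶ Z => f ≫ g) :=
  (CpoCategory.comp_continuous X Y Z).comp (prodMk_left_continuous f)

lemma comp_right_continuous {C : Type u₁} [Category.{v₁} C] [CpoCategory C] (X : C) {Y Z : C}
    (g : Y ⟶ Z) : ωScottContinuous (fun f : X ⟶ Y => f ≫ g) :=
  (CpoCategory.comp_continuous X Y Z).comp (prodMk_right_continuous g)

/-- Copairing is continuous if binary coproducts have a universal property of cpos. -/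
lemma isCpoCoproducts_of {C : Type u₁} [Category.{v₁} C] [CpoCategory C] [HasFiniteCoproducts C]
    (h : ∀ X Y : C, ∃ (s : Cocone (pair X Y)) (_ : IsColimit s), IsCpoColimit s) :
    IsCpoCoproducts C := by
  -- Order reflection is transported from the given colimit cocone to the chosen coproduct along the
  -- comparison isomorphism. Monotonicity and continuity of copairing then follow by testing on the
  -- two injections.
  have key : ∀ {X Y Z : C} (f g : X ⨿ Y ⟶ Z), coprod.inl ≫ f ≤ coprod.inl ≫ g →
      coprod.inr ≫ f ≤ coprod.inr ≫ g → f ≤ g := by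
    intro X Y Z f g hl hr
    obtain ⟨s, hs, hs'⟩ := h X Y
    let e := hs.coconePointUniqueUpToIso (colimit.isColimit (pair X Y))
    have he : ∀ j, s.ι.app j ≫ e.hom = colimit.ι (pair X Y) j := fun j =>
      hs.comp_coconePointUniqueUpToIso_hom _ j
    have : e.hom ≫ f ≤ e.hom ≫ g := hs' _ _ fun j => by
      rw [← Category.assoc, ← Category.assoc, he]
      rcases j with ⟨_ | _⟩
      exacts [hl, hr]
    have := comp_le_comp (le_refl e.inv) this
    rwa [e.inv_hom_id_assoc, e.inv_hom_id_assoc] at this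
  intro X Y Z
  refine continuous_of (fun p q h => key _ _ ?_ ?_) fun c z h => key _ _ ?_ ?_
  · exact (coprod.inl_desc p.1 p.2).le.trans (h.1.trans (coprod.inl_desc q.1 q.2).ge)
  · exact (coprod.inr_desc p.1 p.2).le.trans (h.2.trans (coprod.inr_desc q.1 q.2).ge)
  · rw [coprod.inl_desc]
    exact ωSup_le _ _ fun i => (coprod.inl_desc (c i).1 (c i).2).ge.trans
      (comp_le_comp le_rfl (h i))
  · rw [coprod.inr_desc]
    exact ωSup_le _ _ fun i => (coprod.inr_desc (c i).1 (c i).2).ge.trans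
      (comp_le_comp le_rfl (h i))

lemma isCpoCoproducts_cpo : IsCpoCoproducts ωCPO.{u} :=
  isCpoCoproducts_of fun X Y => ⟨_, cpoColimitIsColimit (pair X Y), fun Z f g h I =>
    FreeCpo.le_of_gen_le (f := (f : _ →𝒄 Z)) (g := (g : _ →𝒄 Z)) f.ωScottContinuous g.monotone
      (fun p => h p.1 p.2) I⟩

section Presheaves

variable {M : Type u} [SmallCategory M] [CpoBotCategory M]

/-! ### Presheaves presented by generators and relations -/

namespace Psh

lemma res_id (T : Psh M) {a : M} (x : T.ev a) : T.res (𝟙 a) x = x :=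
  ContinuousHom.congr_fun (congrArg Subtype.val (T.functor.map_id (op a))) x

lemma res_comp (T : Psh M) {a b c : M} (f : a ⟶ b) (g : b ⟶ c) (x : T.ev c) :
    T.res (f ≫ g) x = T.res f (T.res g x) :=
  ContinuousHom.congr_fun (congrArg Subtype.val (T.functor.map_comp g.op f.op)) x

lemma res_bot (T : Psh M) {a b : M} (f : a ⟶ b) : T.res f ⊥ = ⊥ := (T.functor.map f.op).2

lemma bot_res (T : Psh M) {a b : M} (x : T.ev b) : T.res (⊥ : a ⟶ b) x = ⊥ :=
  ContinuousHom.congr_fun (congrArg Subtype.val (T.map_bot a b)) x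

lemma strictHom_val_continuous {α : Type*} [OmegaCompletePartialOrder α] {A B : PCPO.{u}}
    {f : α → (A ⟶ B)} (hf : ωScottContinuous f) (x : A) :
    ωScottContinuous (fun a => (f a).1 x) := by
  refine continuous_of (fun a b h => hf.monotone h x) fun c z h => ?_
  rw [hf.map_ωSup]
  exact ωSup_le _ _ h

lemma res_left_continuous (T : Psh M) {a b : M} (x : T.ev b) :
    ωScottContinuous (fun f : a ⟶ b => T.res f x) :=
  strictHom_val_continuous (T.map_continuous a b) x

lemma res_continuous (T : Psh M) (a b : M) : ωScottContinuous (fun f : a ⟶ b => T.res f) :=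
  (continuous_of (f := fun f : T.ev b ⟶ T.ev a => f.1) (fun _ _ h => h)
    fun _ _ h => ωSup_le _ _ h).comp (T.map_continuous a b)

@[simp]
lemma id_app {T : Psh M} (a : M) (x : T.ev a) : app (𝟙 T) a x = x := rfl

@[simp]
lemma comp_app {T S R : Psh M} (f : T ⟶ S) (g : S ⟶ R) (a : M) (x : T.ev a) :
    app (f ≫ g) a x = app g a (app f a x) := rfl

lemma app_continuous {α : Type*} [OmegaCompletePartialOrder α] {T S : Psh M}
    {f : α → (T ⟶ S)} (hf : ωScottContinuous f) (a : M) (x : T.ev a) :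
    ωScottContinuous (fun i => app (f i) a x) := by
  refine continuous_of (fun i j h => hf.monotone h a x) fun c z h => ?_
  rw [hf.map_ωSup]
  exact ωSup_le _ _ h

end Psh

variable (M) in
/-- Generators and relations for a presheaf on `M`. A generator lives at an object of `M`, and a
relation between restrictions of generators is read as `p ≤ sup s`. -/
structure Presentation where
  /-- The generators. -/
  ι : Type u
  /-- The object at which a generator lives. -/
  dom : ι → M
  -- With a generator available, every value of the presheaf acquires a least element, namely the
  -- restriction of that generator along `⊥`.
  nonempty : M → Nonempty ι
  /-- The relations. -/
  rel : ∀ m : M, (Σ i, m ⟶ dom i) → Set (Σ i, m ⟶ dom i) → Prop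

namespace Presentation

variable (P : Presentation M)

/-- The restrictions of generators to an object. -/
abbrev Gen (m : M) : Type u := Σ i, m ⟶ P.dom i

variable {P} in
/-- The action of `M` on the restrictions of generators. -/
def act {m m' : M} (k : m' ⟶ m) (p : P.Gen m) : P.Gen m' := ⟨p.1, k ≫ p.2⟩

/-- The relations together with those that hold in each presheaf. -/
inductive Rel (m : M) : P.Gen m → Set (P.Gen m) → Prop
  | base {m' : M} (k : m ⟶ m') {p : P.Gen m'} {s : Set (P.Gen m')} (h : P.rel m' p s) :
      Rel m (act k p) (act k '' s)
  | mono {i : P.ι} {f g : m ⟶ P.dom i} (h : f ≤ g) : Rel m ⟨i, f⟩ {⟨i, g⟩}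
  | sup {i : P.ι} (c : Chain (m ⟶ P.dom i)) :
      Rel m ⟨i, ωSup c⟩ (Set.range fun n => ⟨i, c n⟩)
  | bot (i : P.ι) : Rel m ⟨i, ⊥⟩ ∅

/-- A relation with empty right-hand side puts its generator below every element. By `Rel.bot` the
choice of generator is irrelevant. -/
instance (m : M) : OrderBot (FreeCpo (P.Rel m)) where
  bot := FreeCpo.gen _ ⟨(P.nonempty m).some, ⊥⟩
  bot_le _ := FreeCpo.gen_le_of_rel (.bot _) (by simp)

lemma gen_continuous {m : M} (i : P.ι) :
    ωScottContinuous (fun f : m ⟶ P.dom i => FreeCpo.gen (P.Rel m) ⟨i, f⟩) :=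
  continuous_of (fun _ _ h => FreeCpo.gen_le_of_rel (.mono h) (by rintro _ rfl; exact le_rfl))
    fun c _ h => FreeCpo.gen_le_of_rel (.sup c) (by rintro _ ⟨n, rfl⟩; exact h n)

lemma gen_bot {m : M} (i : P.ι) : FreeCpo.gen (P.Rel m) ⟨i, ⊥⟩ = ⊥ :=
  le_bot_iff.1 (FreeCpo.gen_le_of_rel (.bot _) (by simp))

/-- `Rel.base` already contains every restriction of a given relation, so restricting again only
composes the two morphisms. The other relations survive because composition in `M` is continuous and
strict. -/
lemma respects_act {m m' : M} (k : m' ⟶ m) :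
    FreeCpo.Respects (P.Rel m) fun p => FreeCpo.gen (P.Rel m') (act k p) := by
  intro p s h u hu
  cases h with
  | base k' h =>
    have e : ∀ q, act k (act k' q) = act (P := P) (k ≫ k') q := fun q => by
      simp only [act, Category.assoc]
    simp only [e] at hu ⊢
    refine FreeCpo.gen_le_of_rel (.base (k ≫ k') h) ?_
    rintro _ ⟨q, hq, rfl⟩
    rw [← e]
    exact hu _ ⟨q, hq, rfl⟩
  | mono h =>
    exact ((P.gen_continuous _).monotone (comp_le_comp le_rfl h)).trans (hu _ rfl)
  | sup c =>
    exact apply_ωSup_le ((P.gen_continuous _).comp (comp_left_continuous _ k)) c u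
      fun n => hu _ ⟨n, rfl⟩
  | bot i =>
    have : FreeCpo.gen (P.Rel m') (act k ⟨i, (⊥ : m ⟶ P.dom i)⟩) = ⊥ := by
      rw [act, CpoBotCategory.comp_bot]
      exact P.gen_bot i
    exact this.le.trans bot_le

/-- The restriction maps of a presented presheaf. -/
def map {m m' : M} (k : m' ⟶ m) : FreeCpo (P.Rel m) →𝒄 FreeCpo (P.Rel m') :=
  FreeCpo.lift _ (P.respects_act k)

lemma map_gen {m m' : M} (k : m' ⟶ m) (p : P.Gen m) :
    P.map k (FreeCpo.gen _ p) = FreeCpo.gen _ (act k p) := FreeCpo.lift_gen _ p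

lemma map_bot {m m' : M} (k : m' ⟶ m) : P.map k ⊥ = ⊥ := by
  rw [← P.gen_bot (P.nonempty m).some, map_gen, act, CpoBotCategory.comp_bot, gen_bot]

/-- The presheaf given by generators and relations. -/
def psh : Psh M where
  functor :=
    { obj := fun m => PCPO.mk (FreeCpo (P.Rel m.unop))
      map := fun k => ⟨P.map k.unop, P.map_bot k.unop⟩
      map_id := fun m => Subtype.ext (FreeCpo.hom_ext fun p => (P.map_gen _ p).trans (by
        simp only [act, unop_id, Category.id_comp]
        rfl))
      map_comp := fun k l => Subtype.ext (FreeCpo.hom_ext fun p => (P.map_gen _ p).trans (by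
        show _ = P.map l.unop (P.map k.unop _)
        simp only [map_gen, act, unop_comp, Category.assoc])) }
  map_continuous a b := by
    have h := fun i (f : b ⟶ P.dom i) =>
      (P.gen_continuous i).comp (comp_right_continuous a f)
    refine continuous_of (fun f g hfg => FreeCpo.le_of_gen_le
      (f := P.map f) (g := P.map g) (P.map f).ωScottContinuous (P.map g).monotone fun p => ?_)
      fun c z hz => FreeCpo.le_of_gen_le
      (f := P.map (ωSup c)) (g := z.1) (P.map _).ωScottContinuous z.1.monotone fun p => ?_
    · rw [map_gen, map_gen]
      exact (h p.1 p.2).monotone hfg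
    · rw [map_gen]
      exact apply_ωSup_le (h p.1 p.2) c _ fun i => (P.map_gen _ p).ge.trans
        (hz i (FreeCpo.gen _ p))
  map_bot a b := Subtype.ext (FreeCpo.hom_ext fun p => (P.map_gen _ p).trans (by
    show FreeCpo.gen (P.Rel a) ⟨p.1, (⊥ : a ⟶ b) ≫ p.2⟩ = ⊥
    rw [CpoBotCategory.bot_comp]
    exact P.gen_bot p.1))

/-- The generators of a presented presheaf. -/
def elem (i : P.ι) : P.psh.ev (P.dom i) := FreeCpo.gen (P.Rel (P.dom i)) ⟨i, 𝟙 _⟩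

lemma res_elem {m : M} (i : P.ι) (f : m ⟶ P.dom i) :
    P.psh.res f (P.elem i) = FreeCpo.gen (P.Rel m) ⟨i, f⟩ :=
  (P.map_gen f _).trans (by rw [act, Category.comp_id])

/-- The value of a restriction of a generator in a presheaf. -/
def eval {Q : Psh M} (φ : ∀ i, Q.ev (P.dom i)) {m : M} (p : P.Gen m) : Q.ev m :=
  Q.res p.2 (φ p.1)

lemma eval_act {Q : Psh M} (φ : ∀ i, Q.ev (P.dom i)) {m m' : M} (k : m' ⟶ m) (p : P.Gen m) :
    P.eval φ (act k p) = Q.res k (P.eval φ p) := Q.res_comp k p.2 (φ p.1)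

/-- The elements `elem` satisfy the defining relations; the instance of `Rel.base` used is the one
along the identity. -/
lemma elem_le_of_rel {m : M} {p : P.Gen m} {s : Set (P.Gen m)} (h : P.rel m p s)
    {u : P.psh.ev m} (hs : ∀ q ∈ s, P.eval P.elem q ≤ u) : P.eval P.elem p ≤ u := by
  have e : ∀ q : P.Gen m, P.eval P.elem q = FreeCpo.gen (P.Rel m) (act (𝟙 m) q) := fun q => by
    rw [act, Category.id_comp]
    exact P.res_elem q.1 q.2
  rw [e]
  refine FreeCpo.gen_le_of_rel (.base (𝟙 m) h) ?_
  rintro _ ⟨q, hq, rfl⟩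
  rw [← e]
  exact hs q hq

/-- The families of elements of a presheaf which satisfy the relations. -/
def IsModel {Q : Psh M} (φ : ∀ i, Q.ev (P.dom i)) : Prop :=
  -- The condition is imposed after every restriction `k`: an upper bound `u` at `m'` need not come
  -- from one at `m`, so the case of the identity would not suffice.
  ∀ (m : M) (p : P.Gen m) (s : Set (P.Gen m)), P.rel m p s → ∀ {m' : M} (k : m' ⟶ m) (u : Q.ev m'),
    (∀ q ∈ s, Q.res k (P.eval φ q) ≤ u) → Q.res k (P.eval φ p) ≤ u

variable {P} {Q : Psh M}

lemma IsModel.respects {φ : ∀ i, Q.ev (P.dom i)} (hφ : P.IsModel φ) (m : M) :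
    FreeCpo.Respects (P.Rel m) (P.eval φ) := by
  intro p s h u hu
  cases h with
  | base k h =>
    rw [eval_act]
    exact hφ _ _ _ h k u fun q hq => (P.eval_act φ k q).ge.trans (hu _ ⟨q, hq, rfl⟩)
  | mono h => exact ((Q.res_left_continuous _).monotone h).trans (hu _ rfl)
  | sup c => exact apply_ωSup_le (Q.res_left_continuous _) c u fun n => hu _ ⟨n, rfl⟩
  | bot i => exact (Q.bot_res _).le.trans bot_le

/-- The morphism out of a presented presheaf given by a model. -/
def desc (φ : ∀ i, Q.ev (P.dom i)) (hφ : P.IsModel φ) : P.psh ⟶ Q :=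
  Psh.homMk (fun m => FreeCpo.lift _ (hφ.respects m))
    (fun m => by
      -- The least element is a generator restricted along `⊥`, and its image is the restriction of
      -- an element of `Q` along `⊥`.
      refine le_bot_iff.1 (le_of_eq_of_le ?_ (Q.bot_res (a := m) (φ (P.nonempty m).some)).le)
      exact FreeCpo.lift_gen (hφ.respects m) _)
    (fun {a b} k x => ContinuousHom.congr_fun (FreeCpo.hom_ext
      (f := ContinuousHom.comp (FreeCpo.lift _ (hφ.respects a)) (P.map k))
      (g := ContinuousHom.comp (Q.res k) (FreeCpo.lift _ (hφ.respects b))) fun p => by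
        show FreeCpo.lift _ (hφ.respects a) (P.map k _) =
          Q.res k (FreeCpo.lift _ (hφ.respects b) _)
        rw [map_gen, FreeCpo.lift_gen, FreeCpo.lift_gen, eval_act]) x)

lemma desc_elem (φ : ∀ i, Q.ev (P.dom i)) (hφ : P.IsModel φ) (i : P.ι) :
    Psh.app (desc φ hφ) (P.dom i) (P.elem i) = φ i :=
  (FreeCpo.lift_gen (hφ.respects _) _).trans (Q.res_id _)

/-- By naturality an inequality at the generators passes to their restrictions, and from there to
the whole presented cpo by `FreeCpo.le_of_gen_le`. -/
lemma hom_le {f g : P.psh ⟶ Q}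
    (h : ∀ i, Psh.app f (P.dom i) (P.elem i) ≤ Psh.app g (P.dom i) (P.elem i)) : f ≤ g :=
  fun m => FreeCpo.le_of_gen_le (f := Psh.app f m) (g := Psh.app g m)
    (Psh.app f m).ωScottContinuous (Psh.app g m).monotone fun p => by
      have := (Q.res p.2).monotone (h p.1)
      rw [← Psh.app_res, ← Psh.app_res, res_elem] at this
      exact this

end Presentation

/-! ### Colimits of presheaves -/

section PshColimits

variable {J : Type} [SmallCategory J] (D : J ⥤ Psh M)

/-- The relations presenting the colimit of a diagram of presheaves. -/
inductive PshColimitRel : ∀ m : M, (Σ i : (Σ (j : J) (m : M), (D.obj j).ev m), m ⟶ i.2.1) →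
    Set (Σ i : (Σ (j : J) (m : M), (D.obj j).ev m), m ⟶ i.2.1) → Prop
  | mono {j : J} {m : M} {x y : (D.obj j).ev m} (h : x ≤ y) :
      PshColimitRel m ⟨⟨j, m, x⟩, 𝟙 m⟩ {⟨⟨j, m, y⟩, 𝟙 m⟩}
  | sup {j : J} {m : M} (c : Chain ((D.obj j).ev m)) :
      PshColimitRel m ⟨⟨j, m, ωSup c⟩, 𝟙 m⟩ (Set.range fun n => ⟨⟨j, m, c n⟩, 𝟙 m⟩)
  | bot (j : J) (m : M) : PshColimitRel m ⟨⟨j, m, ⊥⟩, 𝟙 m⟩ ∅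
  | le_res {j : J} {m m' : M} (f : m' ⟶ m) (x : (D.obj j).ev m) :
      PshColimitRel m' ⟨⟨j, m', (D.obj j).res f x⟩, 𝟙 m'⟩ {⟨⟨j, m, x⟩, f⟩}
  | res_le {j : J} {m m' : M} (f : m' ⟶ m) (x : (D.obj j).ev m) :
      PshColimitRel m' ⟨⟨j, m, x⟩, f⟩ {⟨⟨j, m', (D.obj j).res f x⟩, 𝟙 m'⟩}
  | le_map {j k : J} (f : j ⟶ k) {m : M} (x : (D.obj j).ev m) :
      PshColimitRel m ⟨⟨j, m, x⟩, 𝟙 m⟩ {⟨⟨k, m, Psh.app (D.map f) m x⟩, 𝟙 m⟩}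
  | map_le {j k : J} (f : j ⟶ k) {m : M} (x : (D.obj j).ev m) :
      PshColimitRel m ⟨⟨k, m, Psh.app (D.map f) m x⟩, 𝟙 m⟩ {⟨⟨j, m, x⟩, 𝟙 m⟩}

variable [Nonempty J]

/-- The presentation of the colimit of a diagram of presheaves. -/
abbrev pshColimit : Presentation M where
  ι := Σ (j : J) (m : M), (D.obj j).ev m
  dom i := i.2.1
  nonempty m := ⟨⟨Classical.arbitrary J, m, ⊥⟩⟩
  rel := PshColimitRel D

/-- The element of the colimit given by an element of a presheaf in the diagram. -/
def pshColimitElem (j : J) {m : M} (x : (D.obj j).ev m) : (pshColimit D).psh.ev m :=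
  (pshColimit D).elem ⟨j, m, x⟩

lemma eval_elem_id {Q : Psh M} (φ : ∀ i, Q.ev ((pshColimit D).dom i)) (j : J) {m : M}
    (x : (D.obj j).ev m) : (pshColimit D).eval φ ⟨⟨j, m, x⟩, 𝟙 m⟩ = φ ⟨j, m, x⟩ :=
  Q.res_id _

lemma pshColimitElem_le {m : M} {j : J} {x : (D.obj j).ev m} {s : Set ((pshColimit D).Gen m)}
    (h : PshColimitRel D m ⟨⟨j, m, x⟩, 𝟙 m⟩ s) {u : (pshColimit D).psh.ev m}
    (hs : ∀ q ∈ s, (pshColimit D).eval (pshColimit D).elem q ≤ u) : pshColimitElem D j x ≤ u :=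
  (eval_elem_id D _ j x).ge.trans ((pshColimit D).elem_le_of_rel h hs)

/-- The coprojections of the colimit of a diagram of presheaves. -/
def pshColimitι (j : J) : D.obj j ⟶ (pshColimit D).psh :=
  Psh.homMk
    (fun m => ContinuousHom.ofFun (fun x => pshColimitElem D j x) (continuous_of
      (fun x y h => pshColimitElem_le D (.mono h) (by
        rintro _ rfl; exact (eval_elem_id D _ j y).le))
      (fun c u h => pshColimitElem_le D (.sup c) (by
        rintro _ ⟨n, rfl⟩; exact (eval_elem_id D _ j (c n)).le.trans (h n)))))
    (fun m => le_bot_iff.1 (pshColimitElem_le D (.bot j m) fun _ h => h.elim))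
    (fun {a b} f x => le_antisymm
      (pshColimitElem_le D (.le_res f x) (by rintro _ rfl; exact le_rfl))
      ((pshColimit D).elem_le_of_rel (.res_le f x) (by
        rintro _ rfl; exact (eval_elem_id D _ j _).le)))

/-- The colimit cocone of a diagram of presheaves. -/
def pshColimitCocone : Cocone D where
  pt := (pshColimit D).psh
  ι :=
    { app := pshColimitι D
      naturality := fun j k f => Psh.hom_ext fun m x => le_antisymm
        (pshColimitElem_le D (.map_le f x) (by
          rintro _ rfl; exact (eval_elem_id D _ j x).le))
        (pshColimitElem_le D (.le_map f x) (by
          rintro _ rfl; exact (eval_elem_id D _ k _).le)) }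

lemma pshColimit_isModel (s : Cocone D) :
    (pshColimit D).IsModel (Q := s.pt) fun i => Psh.app (s.ι.app i.1) i.2.1 i.2.2 := by
  intro m p t h m' k u hu
  have e := fun j {m} x => eval_elem_id (Q := s.pt) D
    (fun i => Psh.app (s.ι.app i.1) i.2.1 i.2.2) j (m := m) x
  -- Restriction along `k` after a component of the cocone is continuous, so the order and supremum
  -- relations remain valid after restriction.
  have hk : ∀ j, ωScottContinuous
      (fun x : (D.obj j).ev m => s.pt.res k (Psh.app (S := s.pt) (s.ι.app j) m x)) := fun j =>
    (s.pt.res k).ωScottContinuous.comp (Psh.app (S := s.pt) (s.ι.app j) m).ωScottContinuous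
  cases h with
  | mono h =>
    rw [e]
    have := hu _ rfl
    rw [e] at this
    exact ((hk _).monotone h).trans this
  | sup c =>
    rw [e]
    refine apply_ωSup_le (hk _) c u fun n => ?_
    have := hu _ ⟨n, rfl⟩
    rw [e] at this
    exact this
  | bot j m =>
    rw [e, Psh.app_bot, Psh.res_bot]
    exact bot_le
  | le_res f x =>
    rw [e, Psh.app_res]
    exact hu _ rfl
  | res_le f x =>
    have := hu _ rfl
    rw [e, Psh.app_res] at this
    exact this
  | le_map f x =>
    rw [e]
    have := hu _ rfl
    rw [e, ← Psh.comp_app] at this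
    rwa [← s.w f]
  | map_le f x =>
    have := hu _ rfl
    rw [e, ← s.w f] at this
    rw [e]
    exact this

/-- The universal property of the colimit of a diagram of presheaves. -/
def pshColimitIsColimit : IsColimit (pshColimitCocone D) where
  desc s := Presentation.desc _ (pshColimit_isModel D s)
  fac s j := Psh.hom_ext fun m x => Presentation.desc_elem _ (pshColimit_isModel D s) ⟨j, m, x⟩
  uniq s f h := by
    have e : ∀ i, Psh.app f _ ((pshColimit D).elem i) =
        Psh.app (Presentation.desc _ (pshColimit_isModel D s)) _ ((pshColimit D).elem i) :=
      fun i => (congrArg (fun g => Psh.app g i.2.1 i.2.2) (h i.1)).trans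
        (Presentation.desc_elem _ (pshColimit_isModel D s) i).symm
    exact le_antisymm (Presentation.hom_le fun i => (e i).le)
      (Presentation.hom_le fun i => (e i).ge)

lemma isCpoColimit_pshColimitCocone : IsCpoColimit (pshColimitCocone D) :=
  fun _ _ _ h => Presentation.hom_le fun i => h i.1 i.2.1 i.2.2

lemma hasColimit_psh : HasColimit D := ⟨_, pshColimitIsColimit D⟩

end PshColimits

/-! ### The initial presheaf and coproducts of presheaves -/

/-- The presheaf with one element at each object. -/
def pshZero : Psh M where
  functor :=
    { obj := fun _ => PCPO.mk PUnit
      map := fun _ => 𝟙 _ }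
  map_continuous _ _ := continuous_of (fun _ _ _ => le_rfl) fun _ _ h => h 0
  map_bot _ _ := rfl

/-- The presheaf with one element at each object is initial. -/
def pshZeroIsInitial : IsInitial (pshZero : Psh M) :=
  IsInitial.ofUniqueHom (fun _ => ⊥) fun _ f => Psh.hom_ext fun a _ => Psh.app_bot f a

/-- The projection is `⊥`. One equation is an equality of endomorphisms of an initial object, and
the other composite is `⊥` by strictness, hence below the identity. -/
lemma isEInitial_of_isInitial {C : Type u₁} [Category.{v₁} C] [CpoBotCategory C] {Z : C}
    (hZ : IsInitial Z) : IsEInitial Z :=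
  ⟨⟨hZ⟩, fun _ f => ⟨⊥, hZ.hom_ext _ _, by rw [CpoBotCategory.bot_comp]; exact bot_le⟩⟩

/-- The presented colimits cover nonempty shapes only, since their least elements come from an
object of the diagram. The empty coproduct is supplied by the one-point presheaf. -/
instance : HasFiniteCoproducts (Psh M) :=
  haveI : HasInitial (Psh M) := pshZeroIsInitial.hasInitial
  haveI : HasBinaryCoproducts (Psh M) := ⟨fun D => hasColimit_psh D⟩
  hasFiniteCoproducts_of_has_binary_and_initial

lemma isCpoCoproducts_psh : IsCpoCoproducts (Psh M) :=
  isCpoCoproducts_of fun X Y =>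
    ⟨_, pshColimitIsColimit (pair X Y), isCpoColimit_pshColimitCocone _⟩

end Presheaves

lemma prodMk_continuous {α β γ : Type*} [OmegaCompletePartialOrder α]
    [OmegaCompletePartialOrder β] [OmegaCompletePartialOrder γ] {f : α → β} {g : α → γ}
    (hf : ωScottContinuous f) (hg : ωScottContinuous g) :
    ωScottContinuous (fun x => (f x, g x)) :=
  continuous_of (fun _ _ h => ⟨hf.monotone h, hg.monotone h⟩) fun c z h =>
    ⟨apply_ωSup_le hf c z.1 fun i => (h i).1, apply_ωSup_le hg c z.2 fun i => (h i).2⟩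

section Presheaves

variable {M : Type u} [SmallCategory M] [CpoBotCategory M] [MonoidalCategory M]

/-! ### Bistrict natural families -/

namespace DayBihom

variable {T S R Z : Psh M}

@[ext]
lemma ext {φ ψ : DayBihom T S Z} (h : ∀ a b x y, φ.toFun a b x y = ψ.toFun a b x y) : φ = ψ := by
  cases φ
  cases ψ
  congr
  funext a b x y
  exact h a b x y

variable (φ : DayBihom T S Z)

lemma continuous₂ {α : Type*} [OmegaCompletePartialOrder α] {a b : M} {f : α → T.ev a}
    {g : α → S.ev b} (hf : ωScottContinuous f) (hg : ωScottContinuous g) :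
    ωScottContinuous (fun i => φ.toFun a b (f i) (g i)) :=
  (φ.continuous a b).comp (prodMk_continuous hf hg)

lemma continuous_left (a : M) {b : M} (y : S.ev b) :
    ωScottContinuous (fun x => φ.toFun a b x y) :=
  (φ.continuous a b).comp (prodMk_right_continuous y)

lemma continuous_right {a : M} (b : M) (x : T.ev a) :
    ωScottContinuous (fun y => φ.toFun a b x y) :=
  (φ.continuous a b).comp (prodMk_left_continuous x)

lemma natural_left {a a' b : M} (f : a' ⟶ a) (x : T.ev a) (y : S.ev b) :
    φ.toFun a' b (T.res f x) y = Z.res (f ▷ b) (φ.toFun a b x y) := by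
  rw [← tensorHom_id, ← φ.natural, Psh.res_id]

lemma natural_right {a b b' : M} (g : b' ⟶ b) (x : T.ev a) (y : S.ev b) :
    φ.toFun a b' x (S.res g y) = Z.res (a ◁ g) (φ.toFun a b x y) := by
  rw [← id_tensorHom, ← φ.natural, Psh.res_id]

/-- Composition of a bistrict family with a morphism. -/
def comp (f : Z ⟶ R) : DayBihom T S R where
  toFun a b x y := Psh.app f (a ⊗ b) (φ.toFun a b x y)
  continuous a b := (Psh.app f _).ωScottContinuous.comp (φ.continuous a b)
  bot_left a b y := by rw [φ.bot_left, Psh.app_bot]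
  bot_right a b x := by rw [φ.bot_right, Psh.app_bot]
  natural f g x y := by rw [φ.natural, Psh.app_res]

/-- Composition of a bistrict family with morphisms in both variables. -/
def precomp {T' S' : Psh M} (f : T' ⟶ T) (g : S' ⟶ S) : DayBihom T' S' Z where
  toFun a b x y := φ.toFun a b (Psh.app f a x) (Psh.app g b y)
  continuous a b := φ.continuous₂
    ((Psh.app f a).ωScottContinuous.comp (g := Psh.app f a) (f := Prod.fst) (by fun_prop))
    ((Psh.app g b).ωScottContinuous.comp (g := Psh.app g b) (f := Prod.snd) (by fun_prop))
  bot_left a b y := by rw [Psh.app_bot, φ.bot_left]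
  bot_right a b x := by rw [Psh.app_bot, φ.bot_right]
  natural f g x y := by rw [Psh.app_res, Psh.app_res, φ.natural]

/-- The bistrict family with interchanged variables. -/
def flip [BraidedCategory M] : DayBihom S T Z where
  toFun a b x y := Z.res (β_ a b).hom (φ.toFun b a y x)
  continuous a b := (Z.res _).ωScottContinuous.comp
    (φ.continuous₂ (f := Prod.snd) (g := Prod.fst) (by fun_prop) (by fun_prop))
  bot_left a b y := by rw [φ.bot_right, Psh.res_bot]
  bot_right a b x := by rw [φ.bot_left, Psh.res_bot]
  natural f g x y := by
    rw [φ.natural, ← Psh.res_comp, ← Psh.res_comp, BraidedCategory.braiding_naturality]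

lemma flip_flip [SymmetricCategory M] : φ.flip.flip = φ := by
  ext a b x y
  show Z.res (β_ a b).hom (Z.res (β_ b a).hom _) = _
  -- Flipping twice restricts along a double braiding, so symmetry of `M` is needed here; a braiding
  -- alone defines `flip`.
  rw [← Psh.res_comp, SymmetricCategory.symmetry, Psh.res_id]

/-- The property of a bistrict family to be universal. -/
structure IsUniversal (β : DayBihom T S R) : Prop where
  existsUnique_desc : ∀ {Z : Psh M} (φ : DayBihom T S Z), ∃! f : R ⟶ Z,
    ∀ (a b : M) (x : T.ev a) (y : S.ev b),
      Psh.app f (a ⊗ b) (β.toFun a b x y) = φ.toFun a b x y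
  le_of_le : ∀ {Z : Psh M} (f g : R ⟶ Z),
    (∀ (a b : M) (x : T.ev a) (y : S.ev b),
      Psh.app f (a ⊗ b) (β.toFun a b x y) ≤ Psh.app g (a ⊗ b) (β.toFun a b x y)) → f ≤ g

namespace IsUniversal

variable {β : DayBihom T S R} (hβ : β.IsUniversal)

/-- The morphism out of a universal bistrict family. -/
def desc : R ⟶ Z := (hβ.existsUnique_desc φ).choose

@[simp]
lemma app_desc {a b : M} (x : T.ev a) (y : S.ev b) :
    Psh.app (hβ.desc φ) (a ⊗ b) (β.toFun a b x y) = φ.toFun a b x y :=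
  (hβ.existsUnique_desc φ).choose_spec.1 a b x y

include hβ in
lemma hom_ext {f g : R ⟶ Z} (h : ∀ (a b : M) (x : T.ev a) (y : S.ev b),
    Psh.app f (a ⊗ b) (β.toFun a b x y) = Psh.app g (a ⊗ b) (β.toFun a b x y)) : f = g :=
  le_antisymm (hβ.le_of_le _ _ fun a b x y => (h a b x y).le)
    (hβ.le_of_le _ _ fun a b x y => (h a b x y).ge)

-- Since the universal family reflects the order, continuity in a parameter can be tested on pure
-- tensors. The enrichment of `⊗` and of descent maps is obtained this way.
include hβ in
lemma continuous_of_app {α : Type*} [OmegaCompletePartialOrder α] {f : α → (R ⟶ Z)}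
    (h : ∀ (a b : M) (x : T.ev a) (y : S.ev b),
      ωScottContinuous (fun i => Psh.app (f i) (a ⊗ b) (β.toFun a b x y))) :
    ωScottContinuous f :=
  continuous_of (fun _ _ hij => hβ.le_of_le _ _ fun a b x y => (h a b x y).monotone hij)
    fun c _ hz => hβ.le_of_le _ _ fun a b x y =>
      apply_ωSup_le (h a b x y) c _ fun i => hz i _ _

end IsUniversal

end DayBihom

/-! ### The internal hom of presheaves -/

lemma Psh.res_exchange (Z : Psh M) {a a' c c' : M} (f : a' ⟶ a) (g : c' ⟶ c)
    (z : Z.ev (a ⊗ c)) :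
    Z.res (a' ◁ g) (Z.res (f ▷ c) z) = Z.res (f ▷ c') (Z.res (a ◁ g) z) := by
  rw [← Psh.res_comp, ← Psh.res_comp, whisker_exchange]

lemma Psh.res_whiskerLeft_comp (Z : Psh M) {a c c' c'' : M} (f : c'' ⟶ c') (g : c' ⟶ c)
    (z : Z.ev (a ⊗ c)) : Z.res (a ◁ (f ≫ g)) z = Z.res (a ◁ f) (Z.res (a ◁ g) z) := by
  rw [whiskerLeft_comp, Psh.res_comp]

lemma Psh.res_whiskerLeft_id (Z : Psh M) {a c : M} (z : Z.ev (a ⊗ c)) :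
    Z.res (a ◁ 𝟙 c) z = z := by
  rw [whiskerLeft_id, Psh.res_id]

section InternalHom

variable [CpoBotMonoidal M]

lemma whiskerRight_continuous (a b c : M) : ωScottContinuous (fun f : a ⟶ b => f ▷ c) := by
  simp only [← tensorHom_id]
  exact (CpoBotMonoidal.tensor_continuous (C := M) a b c c).comp (prodMk_right_continuous (𝟙 c))

lemma whiskerLeft_continuous (a b c : M) : ωScottContinuous (fun f : a ⟶ b => c ◁ f) := by
  simp only [← id_tensorHom]
  exact (CpoBotMonoidal.tensor_continuous (C := M) c c a b).comp (prodMk_left_continuous (𝟙 c))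

lemma bot_whiskerRight (a b c : M) : (⊥ : a ⟶ b) ▷ c = ⊥ := by
  rw [← tensorHom_id, CpoBotMonoidal.bot_tensor]

lemma whiskerLeft_bot (a b c : M) : c ◁ (⊥ : a ⟶ b) = ⊥ := by
  rw [← id_tensorHom, CpoBotMonoidal.tensor_bot]

lemma Psh.res_whiskerLeft_bot (Z : Psh M) {a c c' : M} (z : Z.ev (a ⊗ c)) :
    Z.res (a ◁ (⊥ : c' ⟶ c)) z = ⊥ := by
  rw [whiskerLeft_bot, Psh.bot_res]

/-- The presheaf `Z (- ⊗ c)`. -/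
def shift (Z : Psh M) (c : M) : Psh M where
  functor := (tensorRight c).op ⋙ Z.functor
  map_continuous a b := (Z.map_continuous _ _).comp (whiskerRight_continuous a b c)
  map_bot a b := (congrArg (fun f : a ⊗ c ⟶ b ⊗ c => Z.functor.map f.op)
    (bot_whiskerRight a b c)).trans (Z.map_bot _ _)

/-- The functor `c ↦ Z (- ⊗ c)`. -/
def shiftFunctor (Z : Psh M) : Mᵒᵖ ⥤ Psh M where
  obj c := shift Z c.unop
  map {c c'} g := Psh.homMk (T := shift Z c.unop) (S := shift Z c'.unop)
    (fun a => Z.res (a ◁ g.unop)) (fun _ => Z.res_bot _)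
    (fun f x => Z.res_exchange f g.unop x)
  map_id c := Psh.hom_ext fun _ x => Z.res_whiskerLeft_id (c := c.unop) x
  map_comp f g := Psh.hom_ext fun _ x => Z.res_whiskerLeft_comp g.unop f.unop x

/-- The internal hom of presheaves, whose value at `c` consists of the morphisms
`T ⟶ Z (- ⊗ c)`. -/
def internalHom (T Z : Psh M) : Psh M where
  functor := shiftFunctor Z ⋙ Psh.homFunctor T
  map_continuous b c := by
    -- The order on morphisms is pointwise, so it suffices to vary `g` with `f` and `x` fixed, where
    -- continuity of `⊗` in `M` applies.
    have h : ∀ (f : T ⟶ shift Z c) (a : M) (x : T.ev a),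
        ωScottContinuous (fun g : b ⟶ c => Z.res (a ◁ g) (Psh.app f a x)) := fun f a x =>
      (Z.res_left_continuous _).comp (whiskerLeft_continuous b c a)
    exact continuous_of (fun _ _ hg f a x => (h f a x).monotone hg)
      fun d z hz f a x => apply_ωSup_le (h f a x) d _ fun i => hz i f a x
  map_bot b c := Subtype.ext (ContinuousHom.ext _ _ fun f => Psh.hom_ext fun a x =>
    Z.res_whiskerLeft_bot (Psh.app (show T ⟶ shift Z c from f) a x))

variable {T S R Z : Psh M}

/-- The elements of the internal hom as families of functions. -/
def internalHomApp {c : M} (f : (internalHom T Z).ev c) (a : M) : T.ev a →𝒄 Z.ev (a ⊗ c) :=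
  Psh.app (show T ⟶ shift Z c from f) a

namespace DayBihom

variable (φ : DayBihom T S Z)

/-- A bistrict family with fixed second argument. -/
def fixRight {b : M} (y : S.ev b) : T ⟶ shift Z b :=
  Psh.homMk (S := shift Z b)
    (fun a => ContinuousHom.ofFun (fun x => φ.toFun a b x y) (φ.continuous_left a y))
    (fun a => φ.bot_left a b y) (fun f x => φ.natural_left f x y)

/-- Currying of bistrict families. -/
def curry : S ⟶ internalHom T Z :=
  Psh.homMk (S := internalHom T Z)
    (fun b => ContinuousHom.ofFun (β := T ⟶ shift Z b) (fun y => φ.fixRight y)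
      (continuous_of (fun _ _ h _ x => (φ.continuous_right b x).monotone h)
        fun c _ h a x => apply_ωSup_le (φ.continuous_right b x) c _ fun i => h i a x))
    (fun b => Psh.hom_ext fun a x => φ.bot_right a b x)
    (fun g y => Psh.hom_ext fun _ x => φ.natural_right g x y)

/-- Uncurrying of bistrict families. -/
def uncurry (f : S ⟶ internalHom T Z) : DayBihom T S Z where
  toFun a b x y := internalHomApp (Psh.app f b y) a x
  continuous a b := by
    have h : ωScottContinuous (fun p : T.ev a × S.ev b => internalHomApp (Psh.app f b p.2) a) := by
      have h₁ : ωScottContinuous (fun y : S.ev b => internalHomApp (Psh.app f b y) a) :=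
        (Psh.appHom_continuous (T := T) (S := shift Z b) a).comp
          (Psh.app f b).ωScottContinuous
      exact h₁.comp (f := Prod.snd) (by fun_prop)
    fun_prop
  bot_left a b y := Psh.app_bot (T := T) (S := shift Z b) (Psh.app f b y) a
  bot_right a b x :=
    congrArg (fun g => internalHomApp (T := T) (Z := Z) g a x) (Psh.app_bot f b)
  natural {a a' b b'} k l x y := by
    rw [Psh.app_res]
    have h := Psh.app_res (T := T) (S := shift Z b) (Psh.app f b y) k x
    refine (congrArg (Z.res (a' ◁ l)) h).trans ?_
    -- Naturality in the two variables separately has been applied; factoring `k ⊗ₘ l` through the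
    -- two whiskerings joins them.
    rw [tensorHom_def', Z.res_comp]
    rfl

/-- Bistrict families as morphisms to the internal hom. -/
def curryEquiv : DayBihom T S Z ≃ (S ⟶ internalHom T Z) where
  toFun := curry
  invFun := uncurry
  left_inv _ := rfl
  right_inv _ := rfl

namespace IsUniversal

variable {β : DayBihom T S R} (hβ : β.IsUniversal)

-- Fixing the second argument turns a family out of `R` and `Q` into morphisms `R ⟶ Z (- ⊗ c)`, to
-- which the universal property of `R` applies.
include hβ in
lemma bihom_ext_left {Q : Psh M} {φ ψ : DayBihom R Q Z}
    (h : ∀ (a b c : M) (x : T.ev a) (y : S.ev b) (z : Q.ev c),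
      φ.toFun (a ⊗ b) c (β.toFun a b x y) z = ψ.toFun (a ⊗ b) c (β.toFun a b x y) z) : φ = ψ := by
  ext m c w z
  have : φ.fixRight z = ψ.fixRight z := hβ.hom_ext fun a b x y => h a b c x y z
  exact congrArg (fun f => Psh.app f m w) this

-- Flipping moves `R` into the first variable, and `flip` is an involution.
include hβ in
lemma bihom_ext_right [SymmetricCategory M] {Q : Psh M} {φ ψ : DayBihom Q R Z}
    (h : ∀ (a b c : M) (x : Q.ev a) (y : T.ev b) (z : S.ev c),
      φ.toFun a (b ⊗ c) x (β.toFun b c y z) = ψ.toFun a (b ⊗ c) x (β.toFun b c y z)) : φ = ψ := by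
  have : φ.flip = ψ.flip := hβ.bihom_ext_left fun a b c x y z =>
    congrArg (Z.res (β_ (a ⊗ b) c).hom) (h c a b z x y)
  rw [← φ.flip_flip, this, ψ.flip_flip]

/-- The bistrict family out of a universal one given by a tristrict family. -/
def descLeft {Q : Psh M} (t : ∀ c, Q.ev c → DayBihom T S (shift Z c))
    (ht : ∀ (a b c : M) (x : T.ev a) (y : S.ev b),
      ωScottContinuous (fun z => ((t c z).toFun a b x y : Z.ev ((a ⊗ b) ⊗ c))))
    (hbot : ∀ (a b c : M) (x : T.ev a) (y : S.ev b),
      ((t c ⊥).toFun a b x y : Z.ev ((a ⊗ b) ⊗ c)) = ⊥)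
    (hn : ∀ {a b c c' : M} (g : c' ⟶ c) (x : T.ev a) (y : S.ev b) (z : Q.ev c),
      (t c' (Q.res g z)).toFun a b x y = Z.res ((a ⊗ b) ◁ g) ((t c z).toFun a b x y)) :
    DayBihom R Q Z :=
  -- For each fixed `z` the family descends to a morphism `R ⟶ Z (- ⊗ c)`. Letting `z` vary gives a
  -- morphism `Q ⟶ [R, Z]`, whose strictness and naturality are tested on pure tensors.
  uncurry (Psh.homMk (S := internalHom R Z)
    (fun c => ContinuousHom.ofFun (β := R ⟶ shift Z c) (fun z => hβ.desc (t c z))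
      (hβ.continuous_of_app fun a b x y => by
        simp only [app_desc]
        exact ht a b c x y))
    (fun c => hβ.hom_ext fun a b x y => (hβ.app_desc _ x y).trans (hbot a b c x y))
    (fun {c' c} g z => hβ.hom_ext fun a b x y =>
      ((hβ.app_desc _ x y).trans (hn g x y z)).trans
        (congrArg (Z.res ((a ⊗ b) ◁ g)) (hβ.app_desc (t c z) x y).symm)))

lemma descLeft_toFun {Q : Psh M} (t : ∀ c, Q.ev c → DayBihom T S (shift Z c)) (ht hbot hn)
    {a b c : M} (x : T.ev a) (y : S.ev b) (z : Q.ev c) :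
    (hβ.descLeft (Z := Z) t ht hbot hn).toFun (a ⊗ b) c (β.toFun a b x y) z =
      (t c z).toFun a b x y := hβ.app_desc (t c z) x y

end IsUniversal

end DayBihom

end InternalHom

end Presheaves

section Presheaves

variable {M : Type u} [SmallCategory M] [CpoBotCategory M] [MonoidalCategory M]

/-! ### The Day convolution of two presheaves -/

section DayTensor

variable (T S : Psh M)

/-- The relations presenting the Day convolution of two presheaves. -/
inductive DayRel : ∀ m : M, (Σ i : (Σ (a b : M), T.ev a × S.ev b), m ⟶ i.1 ⊗ i.2.1) →
    Set (Σ i : (Σ (a b : M), T.ev a × S.ev b), m ⟶ i.1 ⊗ i.2.1) → Prop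
  | mono {a b : M} {p q : T.ev a × S.ev b} (h : p ≤ q) :
      DayRel (a ⊗ b) ⟨⟨a, b, p⟩, 𝟙 _⟩ {⟨⟨a, b, q⟩, 𝟙 _⟩}
  | sup {a b : M} (c : Chain (T.ev a × S.ev b)) :
      DayRel (a ⊗ b) ⟨⟨a, b, ωSup c⟩, 𝟙 _⟩ (Set.range fun n => ⟨⟨a, b, c n⟩, 𝟙 _⟩)
  | bot_left {a b : M} (y : S.ev b) : DayRel (a ⊗ b) ⟨⟨a, b, ⊥, y⟩, 𝟙 _⟩ ∅
  | bot_right {a b : M} (x : T.ev a) : DayRel (a ⊗ b) ⟨⟨a, b, x, ⊥⟩, 𝟙 _⟩ ∅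
  | le_res {a a' b b' : M} (f : a' ⟶ a) (g : b' ⟶ b) (x : T.ev a) (y : S.ev b) :
      DayRel (a' ⊗ b') ⟨⟨a', b', T.res f x, S.res g y⟩, 𝟙 _⟩ {⟨⟨a, b, x, y⟩, f ⊗ₘ g⟩}
  | res_le {a a' b b' : M} (f : a' ⟶ a) (g : b' ⟶ b) (x : T.ev a) (y : S.ev b) :
      DayRel (a' ⊗ b') ⟨⟨a, b, x, y⟩, f ⊗ₘ g⟩ {⟨⟨a', b', T.res f x, S.res g y⟩, 𝟙 _⟩}

/-- The presentation of the Day convolution of two presheaves. -/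
abbrev dayPresentation : Presentation M where
  ι := Σ (a b : M), T.ev a × S.ev b
  dom i := i.1 ⊗ i.2.1
  nonempty _ := ⟨⟨𝟙_ M, 𝟙_ M, ⊥, ⊥⟩⟩
  rel := DayRel T S

/-- The Day convolution of two presheaves. -/
def dayTensor : Psh M := (dayPresentation T S).psh

variable {T S} in
/-- The element of the Day convolution given by two elements. -/
def dayElem {a b : M} (p : T.ev a × S.ev b) : (dayTensor T S).ev (a ⊗ b) :=
  (dayPresentation T S).elem ⟨a, b, p⟩

lemma dayEval_id {Q : Psh M} (φ : ∀ i, Q.ev ((dayPresentation T S).dom i)) {a b : M}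
    (p : T.ev a × S.ev b) : (dayPresentation T S).eval φ ⟨⟨a, b, p⟩, 𝟙 _⟩ = φ ⟨a, b, p⟩ :=
  Q.res_id _

lemma dayElem_le {a b : M} {p : T.ev a × S.ev b} {s : Set ((dayPresentation T S).Gen (a ⊗ b))}
    (h : DayRel T S (a ⊗ b) ⟨⟨a, b, p⟩, 𝟙 _⟩ s) {u : (dayTensor T S).ev (a ⊗ b)}
    (hs : ∀ q ∈ s, (dayPresentation T S).eval (dayPresentation T S).elem q ≤ u) :
    dayElem p ≤ u :=
  (dayEval_id T S _ p).ge.trans ((dayPresentation T S).elem_le_of_rel h hs)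

/-- The universal bistrict family. -/
def dayBihom : DayBihom T S (dayTensor T S) where
  toFun a b x y := dayElem (x, y)
  continuous a b := continuous_of
    (fun p q h => dayElem_le T S (.mono h) (by
      rintro _ rfl; exact (dayEval_id T S _ _).le))
    (fun c u h => dayElem_le T S (.sup c) (by
      rintro _ ⟨n, rfl⟩; exact (dayEval_id T S _ _).le.trans (h n)))
  bot_left a b y := le_bot_iff.1 (dayElem_le T S (.bot_left y) fun _ h => h.elim)
  bot_right a b x := le_bot_iff.1 (dayElem_le T S (.bot_right x) fun _ h => h.elim)
  natural f g x y := le_antisymm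
    (dayElem_le T S (.le_res f g x y) (by rintro _ rfl; exact le_rfl))
    ((dayPresentation T S).elem_le_of_rel (.res_le f g x y) (by
      rintro _ rfl; exact (dayEval_id T S _ _).le))

variable {T S}

/-- The constructors of `DayRel` match the axioms of a bistrict natural family one by one: order and
suprema for continuity, the two empty relations for strictness, and the two inequalities with `res`
for naturality. -/
lemma DayBihom.isModel {Z : Psh M} (φ : DayBihom T S Z) :
    (dayPresentation T S).IsModel (Q := Z) fun i => φ.toFun i.1 i.2.1 i.2.2.1 i.2.2.2 := by
  intro m p t h m' k u hu
  have e := fun {a b} p => dayEval_id (Q := Z) T S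
    (fun i => φ.toFun i.1 i.2.1 i.2.2.1 i.2.2.2) (a := a) (b := b) p
  have hk : ∀ {a b} (k : m' ⟶ a ⊗ b), ωScottContinuous
      (fun p : T.ev a × S.ev b => Z.res k (φ.toFun a b p.1 p.2)) := fun k =>
    (Z.res k).ωScottContinuous.comp (φ.continuous _ _)
  cases h with
  | mono h =>
    rw [e]
    have := hu _ rfl
    rw [e] at this
    exact ((hk k).monotone h).trans this
  | sup c =>
    rw [e]
    refine apply_ωSup_le (hk k) c u fun n => ?_
    have := hu _ ⟨n, rfl⟩
    rw [e] at this
    exact this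
  | bot_left y =>
    rw [e, φ.bot_left, Psh.res_bot]
    exact bot_le
  | bot_right x =>
    rw [e, φ.bot_right, Psh.res_bot]
    exact bot_le
  | le_res f g x y =>
    rw [e, φ.natural]
    exact hu _ rfl
  | res_le f g x y =>
    have := hu _ rfl
    rw [e, φ.natural] at this
    exact this

lemma dayBihom_isUniversal : (dayBihom T S).IsUniversal where
  existsUnique_desc φ := ⟨Presentation.desc _ φ.isModel,
    fun a b x y => Presentation.desc_elem _ φ.isModel ⟨a, b, x, y⟩, fun f h => by
      have e : ∀ i, Psh.app f _ ((dayPresentation T S).elem i) =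
          Psh.app (Presentation.desc _ φ.isModel) _ ((dayPresentation T S).elem i) :=
        fun i => (h i.1 i.2.1 i.2.2.1 i.2.2.2).trans (Presentation.desc_elem _ φ.isModel i).symm
      exact le_antisymm (Presentation.hom_le fun i => (e i).le)
        (Presentation.hom_le fun i => (e i).ge)⟩
  le_of_le _ _ h := Presentation.hom_le fun i => h i.1 i.2.1 i.2.2.1 i.2.2.2

end DayTensor

end Presheaves

/-- Both sides realize the same permutation of the three factors. The hexagon identities resolve the
braidings with a tensor product, and symmetry cancels the resulting pairs. It allows the inverse
associator of presheaves to be built from the associator. -/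
lemma braiding_conj_associator {C : Type u₁} [Category.{v₁} C] [MonoidalCategory C]
    [SymmetricCategory C] (a b c : C) :
    (β_ a (b ⊗ c)).hom ≫ (β_ b c).hom ▷ a ≫ (α_ c b a).hom ≫ (β_ c (b ⊗ a)).hom ≫
      (β_ b a).hom ▷ c = (α_ a b c).inv := by
  have h₁ : ∀ {X Y Z W : C} (f : (X ⊗ Y) ⊗ Z ⟶ W),
      (β_ X Y).hom ▷ Z ≫ (β_ Y X).hom ▷ Z ≫ f = f := fun f => by
    rw [← comp_whiskerRight_assoc, SymmetricCategory.symmetry, id_whiskerRight, Category.id_comp]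
  have h₂ : ∀ {X Y Z W : C} (f : Z ⊗ X ⊗ Y ⟶ W),
      Z ◁ (β_ X Y).hom ≫ Z ◁ (β_ Y X).hom ≫ f = f := fun f => by
    rw [← whiskerLeft_comp_assoc, SymmetricCategory.symmetry, whiskerLeft_id, Category.id_comp]
  simp [h₁, h₂, ← comp_whiskerRight]

section Presheaves

variable {M : Type u} [SmallCategory M] [CpoBotCategory M] [MonoidalCategory M]

/-! ### The symmetric monoidal structure given by Day convolution -/

section DayMonoidal

variable {T T' S S' R R' Q Z : Psh M}

/-- The element of the Day convolution given by a pair of elements. -/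
def dayMk {a b : M} (x : T.ev a) (y : S.ev b) : (dayTensor T S).ev (a ⊗ b) :=
  (dayBihom T S).toFun a b x y

lemma dayMk_continuous {α : Type*} [OmegaCompletePartialOrder α] {a b : M} {f : α → T.ev a}
    {g : α → S.ev b} (hf : ωScottContinuous f) (hg : ωScottContinuous g) :
    ωScottContinuous (fun i => dayMk (f i) (g i)) := (dayBihom T S).continuous₂ hf hg

lemma dayMk_bot_left {a b : M} (y : S.ev b) : dayMk (⊥ : T.ev a) y = ⊥ :=
  (dayBihom T S).bot_left a b y

lemma dayMk_bot_right {a b : M} (x : T.ev a) : dayMk x (⊥ : S.ev b) = ⊥ :=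
  (dayBihom T S).bot_right a b x

lemma dayMk_res {a a' b b' : M} (f : a' ⟶ a) (g : b' ⟶ b) (x : T.ev a) (y : S.ev b) :
    dayMk (T.res f x) (S.res g y) = (dayTensor T S).res (f ⊗ₘ g) (dayMk x y) :=
  (dayBihom T S).natural f g x y

lemma dayMk_res_left {a a' b : M} (f : a' ⟶ a) (x : T.ev a) (y : S.ev b) :
    dayMk (T.res f x) y = (dayTensor T S).res (f ▷ b) (dayMk x y) :=
  (dayBihom T S).natural_left f x y

lemma dayMk_res_right {a b b' : M} (g : b' ⟶ b) (x : T.ev a) (y : S.ev b) :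
    dayMk x (S.res g y) = (dayTensor T S).res (a ◁ g) (dayMk x y) :=
  (dayBihom T S).natural_right g x y

lemma dayTensor_hom_ext {f g : dayTensor T S ⟶ Z}
    (h : ∀ (a b : M) (x : T.ev a) (y : S.ev b),
      Psh.app f (a ⊗ b) (dayMk x y) = Psh.app g (a ⊗ b) (dayMk x y)) : f = g :=
  dayBihom_isUniversal.hom_ext h

/-- Functoriality of Day convolution. -/
def dayMap (f : T ⟶ T') (g : S ⟶ S') : dayTensor T S ⟶ dayTensor T' S' :=
  dayBihom_isUniversal.desc ((dayBihom T' S').precomp f g)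

lemma app_dayMap (f : T ⟶ T') (g : S ⟶ S') {a b : M} (x : T.ev a) (y : S.ev b) :
    Psh.app (dayMap f g) (a ⊗ b) (dayMk x y) = dayMk (Psh.app f a x) (Psh.app g b y) :=
  dayBihom_isUniversal.app_desc _ x y

/-- Morphisms to the unit as elements of the presheaf represented by the unit. -/
def unitElem {a : M} (f : a ⟶ 𝟙_ M) : (Psh.representable (𝟙_ M)).ev a := f

/-- Elements of the presheaf represented by the unit as morphisms to the unit. -/
def unitElemHom {a : M} (f : (Psh.representable (𝟙_ M)).ev a) : a ⟶ 𝟙_ M := f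

/-- The Yoneda principle: every element of the unit presheaf is a restriction of the identity. Hence
the unitors are inverted by inserting that one element. -/
lemma res_unitElem_id {a : M} (f : (Psh.representable (𝟙_ M)).ev a) :
    (Psh.representable (𝟙_ M)).res (unitElemHom f) (unitElem (𝟙 _)) = f :=
  Category.comp_id (unitElemHom f)

lemma res_leftUnitor_natural (T : Psh M) {a a' b b' : M} (f : a' ⟶ a) (g : b' ⟶ b)
    (h : a ⟶ 𝟙_ M) (x : T.ev b) :
    T.res ((f ≫ h) ▷ b' ≫ (λ_ b').hom) (T.res g x) =
      T.res (f ⊗ₘ g) (T.res (h ▷ b ≫ (λ_ b).hom) x) := by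
  rw [← Psh.res_comp, ← Psh.res_comp]
  simp [MonoidalCategory.tensorHom_def, whisker_exchange_assoc]

lemma res_rightUnitor_natural (T : Psh M) {a a' b b' : M} (f : a' ⟶ a) (g : b' ⟶ b)
    (x : T.ev a) (h : b ⟶ 𝟙_ M) :
    T.res (a' ◁ (g ≫ h) ≫ (ρ_ a').hom) (T.res f x) =
      T.res (f ⊗ₘ g) (T.res (a ◁ h ≫ (ρ_ a).hom) x) := by
  rw [← Psh.res_comp, ← Psh.res_comp]
  simp [MonoidalCategory.tensorHom_def', ← whisker_exchange_assoc]

/-- The inverse left unitor of Day convolution. -/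
def dayLeftUnitorInv (T : Psh M) : T ⟶ dayTensor (Psh.representable (𝟙_ M)) T :=
  Psh.homMk
    (fun a => ContinuousHom.ofFun
      (fun x => (dayTensor _ T).res (λ_ a).inv (dayMk (unitElem (𝟙 (𝟙_ M))) x))
      ((Psh.res _ _).ωScottContinuous.comp (dayMk_continuous .const .id)))
    (fun a => (congrArg _ (dayMk_bot_right _)).trans (Psh.res_bot _ _))
    (fun f x => by
      show (dayTensor _ T).res _ (dayMk _ (T.res f x)) =
        (dayTensor _ T).res f ((dayTensor _ T).res _ (dayMk _ x))
      rw [dayMk_res_right, ← Psh.res_comp, ← Psh.res_comp, leftUnitor_inv_naturality])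

lemma app_dayLeftUnitorInv {a : M} (x : T.ev a) :
    Psh.app (dayLeftUnitorInv T) a x =
      (dayTensor _ T).res (λ_ a).inv (dayMk (unitElem (𝟙 (𝟙_ M))) x) := rfl

/-- The inverse right unitor of Day convolution. -/
def dayRightUnitorInv (T : Psh M) : T ⟶ dayTensor T (Psh.representable (𝟙_ M)) :=
  Psh.homMk
    (fun a => ContinuousHom.ofFun
      (fun x => (dayTensor T _).res (ρ_ a).inv (dayMk x (unitElem (𝟙 (𝟙_ M)))))
      ((Psh.res _ _).ωScottContinuous.comp (dayMk_continuous .id .const)))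
    (fun a => (congrArg _ (dayMk_bot_left _)).trans (Psh.res_bot _ _))
    (fun f x => by
      show (dayTensor T _).res _ (dayMk (T.res f x) _) =
        (dayTensor T _).res f ((dayTensor T _).res _ (dayMk x _))
      rw [dayMk_res_left, ← Psh.res_comp, ← Psh.res_comp, rightUnitor_inv_naturality])

lemma app_dayRightUnitorInv {a : M} (x : T.ev a) :
    Psh.app (dayRightUnitorInv T) a x =
      (dayTensor T _).res (ρ_ a).inv (dayMk x (unitElem (𝟙 (𝟙_ M)))) := rfl

/-- Naturality in all three variables at once; taking some of them to be identities yields both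
naturality conditions required of `associatorBihom`. -/
lemma dayMk_assoc_natural {a a' b b' c c' : M} (f : a' ⟶ a) (g : b' ⟶ b) (h : c' ⟶ c)
    (x : T.ev a) (y : S.ev b) (z : R.ev c) :
    (dayTensor T (dayTensor S R)).res (α_ a' b' c').hom
        (dayMk (T.res f x) (dayMk (S.res g y) (R.res h z))) =
      (dayTensor T (dayTensor S R)).res ((f ⊗ₘ g) ⊗ₘ h)
        ((dayTensor T (dayTensor S R)).res (α_ a b c).hom (dayMk x (dayMk y z))) := by
  rw [dayMk_res g h, dayMk_res, ← Psh.res_comp, ← Psh.res_comp, associator_naturality]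

lemma dayMap_id : dayMap (𝟙 T) (𝟙 S) = 𝟙 (dayTensor T S) :=
  dayTensor_hom_ext fun _ _ _ _ => app_dayMap _ _ _ _

lemma dayMap_comp {T'' S'' : Psh M} (f : T ⟶ T') (g : S ⟶ S') (f' : T' ⟶ T'') (g' : S' ⟶ S'') :
    dayMap f g ≫ dayMap f' g' = dayMap (f ≫ f') (g ≫ g') :=
  dayTensor_hom_ext fun a b x y => by
    simp only [Psh.comp_app, app_dayMap]

variable [CpoBotMonoidal M]

/-- The left unitor of Day convolution as a bistrict family. -/
def leftUnitorBihom (T : Psh M) : DayBihom (Psh.representable (𝟙_ M)) T T where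
  toFun a b f x := T.res (unitElemHom f ▷ b ≫ (λ_ b).hom) x
  continuous a b := by
    have h : ωScottContinuous (fun p : (a ⟶ 𝟙_ M) × T.ev b => T.res (p.1 ▷ b ≫ (λ_ b).hom)) :=
      (T.res_continuous _ _).comp ((comp_right_continuous _ _).comp
        ((whiskerRight_continuous a (𝟙_ M) b).comp (f := Prod.fst) (by fun_prop)))
    exact show ωScottContinuous (fun p : (a ⟶ 𝟙_ M) × T.ev b =>
      T.res (p.1 ▷ b ≫ (λ_ b).hom) p.2) by fun_prop
  bot_left a b x := by
    refine (congrArg (fun f : a ⊗ b ⟶ 𝟙_ M ⊗ b => T.res (f ≫ (λ_ b).hom) x)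
      (bot_whiskerRight a _ b)).trans ?_
    rw [CpoBotCategory.bot_comp, Psh.bot_res]
  bot_right a b f := Psh.res_bot _ _
  natural f g h x := res_leftUnitor_natural T f g (unitElemHom h) x

/-- The right unitor of Day convolution as a bistrict family. -/
def rightUnitorBihom (T : Psh M) : DayBihom T (Psh.representable (𝟙_ M)) T where
  toFun a b x f := T.res (a ◁ unitElemHom f ≫ (ρ_ a).hom) x
  continuous a b := by
    have h : ωScottContinuous (fun p : T.ev a × (b ⟶ 𝟙_ M) => T.res (a ◁ p.2 ≫ (ρ_ a).hom)) :=
      (T.res_continuous _ _).comp ((comp_right_continuous _ _).comp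
        ((whiskerLeft_continuous b (𝟙_ M) a).comp (f := Prod.snd) (by fun_prop)))
    exact show ωScottContinuous (fun p : T.ev a × (b ⟶ 𝟙_ M) =>
      T.res (a ◁ p.2 ≫ (ρ_ a).hom) p.1) by fun_prop
  bot_left a b f := Psh.res_bot _ _
  bot_right a b x := by
    refine (congrArg (fun f : a ⊗ b ⟶ a ⊗ 𝟙_ M => T.res (f ≫ (ρ_ a).hom) x)
      (whiskerLeft_bot b _ a)).trans ?_
    rw [CpoBotCategory.bot_comp, Psh.bot_res]
  natural f g x h := res_rightUnitor_natural T f g x (unitElemHom h)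

/-- The left unitor of Day convolution as a morphism. -/
def dayLeftUnitorHom (T : Psh M) : dayTensor (Psh.representable (𝟙_ M)) T ⟶ T :=
  dayBihom_isUniversal.desc (leftUnitorBihom T)

lemma app_dayLeftUnitorHom {a b : M} (f : (Psh.representable (𝟙_ M)).ev a) (x : T.ev b) :
    Psh.app (dayLeftUnitorHom T) (a ⊗ b) (dayMk f x) =
      T.res (unitElemHom f ▷ b ≫ (λ_ b).hom) x := dayBihom_isUniversal.app_desc _ f x

/-- The right unitor of Day convolution as a morphism. -/
def dayRightUnitorHom (T : Psh M) : dayTensor T (Psh.representable (𝟙_ M)) ⟶ T :=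
  dayBihom_isUniversal.desc (rightUnitorBihom T)

lemma app_dayRightUnitorHom {a b : M} (x : T.ev a) (f : (Psh.representable (𝟙_ M)).ev b) :
    Psh.app (dayRightUnitorHom T) (a ⊗ b) (dayMk x f) =
      T.res (a ◁ unitElemHom f ≫ (ρ_ a).hom) x := dayBihom_isUniversal.app_desc _ x f

/-- The left unitor of Day convolution. -/
def dayLeftUnitor (T : Psh M) : dayTensor (Psh.representable (𝟙_ M)) T ≅ T where
  hom := dayLeftUnitorHom T
  inv := dayLeftUnitorInv T
  hom_inv_id := dayTensor_hom_ext fun a b f x => by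
    rw [Psh.comp_app, app_dayLeftUnitorHom, app_dayLeftUnitorInv, dayMk_res_right,
      ← Psh.res_comp, ← leftUnitor_inv_naturality, Category.assoc, Iso.hom_inv_id,
      Category.comp_id, ← dayMk_res_left, res_unitElem_id, Psh.id_app]
  inv_hom_id := Psh.hom_ext fun a x => by
    rw [Psh.comp_app, app_dayLeftUnitorInv, Psh.app_res, app_dayLeftUnitorHom, ← Psh.res_comp,
      show unitElemHom (unitElem (𝟙 (𝟙_ M))) = 𝟙 _ from rfl, id_whiskerRight, Category.id_comp,
      Iso.inv_hom_id, Psh.res_id, Psh.id_app]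

/-- The right unitor of Day convolution. -/
def dayRightUnitor (T : Psh M) : dayTensor T (Psh.representable (𝟙_ M)) ≅ T where
  hom := dayRightUnitorHom T
  inv := dayRightUnitorInv T
  hom_inv_id := dayTensor_hom_ext fun a b x f => by
    rw [Psh.comp_app, app_dayRightUnitorHom, app_dayRightUnitorInv, dayMk_res_left,
      ← Psh.res_comp, ← rightUnitor_inv_naturality, Category.assoc, Iso.hom_inv_id,
      Category.comp_id, ← dayMk_res_right, res_unitElem_id, Psh.id_app]
  inv_hom_id := Psh.hom_ext fun a x => by
    rw [Psh.comp_app, app_dayRightUnitorInv, Psh.app_res, app_dayRightUnitorHom, ← Psh.res_comp,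
      show unitElemHom (unitElem (𝟙 (𝟙_ M))) = 𝟙 _ from rfl, whiskerLeft_id, Category.id_comp,
      Iso.inv_hom_id, Psh.res_id, Psh.id_app]

/-- Equality on pure tensors suffices for triple products, because fixing the last factor leaves a
morphism out of a binary tensor product. -/
lemma dayTensor_hom_ext₃ {f g : dayTensor (dayTensor T S) R ⟶ Z}
    (h : ∀ (a b c : M) (x : T.ev a) (y : S.ev b) (z : R.ev c),
      Psh.app f ((a ⊗ b) ⊗ c) (dayMk (dayMk x y) z) =
        Psh.app g ((a ⊗ b) ⊗ c) (dayMk (dayMk x y) z)) : f = g := by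
  have : (dayBihom _ R).comp f = (dayBihom _ R).comp g :=
    dayBihom_isUniversal.bihom_ext_left h
  exact dayTensor_hom_ext fun a b x y => congrArg (fun φ => φ.toFun a b x y) this

lemma dayTensor_hom_ext₄ {f g : dayTensor (dayTensor (dayTensor T S) R) Q ⟶ Z}
    (h : ∀ (a b c d : M) (x : T.ev a) (y : S.ev b) (z : R.ev c) (w : Q.ev d),
      Psh.app f (((a ⊗ b) ⊗ c) ⊗ d) (dayMk (dayMk (dayMk x y) z) w) =
        Psh.app g (((a ⊗ b) ⊗ c) ⊗ d) (dayMk (dayMk (dayMk x y) z) w)) : f = g := by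
  refine dayTensor_hom_ext fun m d v w => ?_
  have : ((dayBihom _ Q).comp f).fixRight w = ((dayBihom _ Q).comp g).fixRight w :=
    dayTensor_hom_ext₃ fun a b c x y z => h a b c d x y z w
  exact congrArg (fun f => Psh.app f m v) this

/-- The associator of Day convolution as a bistrict family. -/
def associatorBihom (T S R : Psh M) :
    DayBihom (dayTensor T S) R (dayTensor T (dayTensor S R)) :=
  (dayBihom_isUniversal (T := T) (S := S)).descLeft
    (fun c z =>
      { toFun := fun a b x y =>
          (dayTensor T (dayTensor S R)).res (α_ a b c).hom (dayMk x (dayMk y z))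
        continuous := fun a b => (Psh.res _ _).ωScottContinuous.comp
          (dayMk_continuous (by fun_prop) (dayMk_continuous (by fun_prop) .const))
        bot_left := fun a b y => by
          rw [dayMk_bot_left, Psh.res_bot]
          rfl
        bot_right := fun a b x => by
          rw [dayMk_bot_left, dayMk_bot_right, Psh.res_bot]
          rfl
        natural := fun f g x y => by
          have := dayMk_assoc_natural f g (𝟙 c) x y z
          rw [Psh.res_id, tensorHom_id] at this
          exact this })
    (fun a b c x y => (Psh.res _ _).ωScottContinuous.comp
      (dayMk_continuous .const (dayMk_continuous .const .id)))
    (fun a b c x y => by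
      show (dayTensor T (dayTensor S R)).res (α_ a b c).hom (dayMk x (dayMk y ⊥)) = ⊥
      rw [dayMk_bot_right, dayMk_bot_right, Psh.res_bot])
    (fun {a b c c'} g x y z => by
      have := dayMk_assoc_natural (𝟙 a) (𝟙 b) g x y z
      rwa [Psh.res_id, Psh.res_id, id_tensorHom_id, id_tensorHom] at this)

/-- The associator of Day convolution as a morphism. -/
def dayAssociatorHom (T S R : Psh M) :
    dayTensor (dayTensor T S) R ⟶ dayTensor T (dayTensor S R) :=
  dayBihom_isUniversal.desc (associatorBihom T S R)

lemma app_dayAssociatorHom {a b c : M} (x : T.ev a) (y : S.ev b) (z : R.ev c) :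
    Psh.app (dayAssociatorHom T S R) ((a ⊗ b) ⊗ c) (dayMk (dayMk x y) z) =
      (dayTensor T (dayTensor S R)).res (α_ a b c).hom (dayMk x (dayMk y z)) :=
  (dayBihom_isUniversal.app_desc _ _ z).trans
    (dayBihom_isUniversal.descLeft_toFun _ _ _ _ x y z)

lemma dayAssociatorHom_naturality (f : T ⟶ T') (g : S ⟶ S') (h : R ⟶ R') :
    dayMap (dayMap f g) h ≫ dayAssociatorHom T' S' R' =
      dayAssociatorHom T S R ≫ dayMap f (dayMap g h) :=
  dayTensor_hom_ext₃ fun a b c x y z => by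
    simp only [Psh.comp_app, app_dayMap, app_dayAssociatorHom, Psh.app_res]

lemma dayLeftUnitorHom_naturality (f : T ⟶ S) :
    dayMap (𝟙 (Psh.representable (𝟙_ M))) f ≫ dayLeftUnitorHom S = dayLeftUnitorHom T ≫ f :=
  dayTensor_hom_ext fun a b x y => by
    simp only [Psh.comp_app, app_dayMap, app_dayLeftUnitorHom, Psh.app_res, Psh.id_app]

lemma dayRightUnitorHom_naturality (f : T ⟶ S) :
    dayMap f (𝟙 (Psh.representable (𝟙_ M))) ≫ dayRightUnitorHom S = dayRightUnitorHom T ≫ f :=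
  dayTensor_hom_ext fun a b x y => by
    simp only [Psh.comp_app, app_dayMap, app_dayRightUnitorHom, Psh.app_res, Psh.id_app]

/-- On a pure tensor each associator becomes a restriction along an associator of `M`. Collecting
these restrictions turns both sides into the pentagon of `M`. -/
lemma day_pentagon (T S R Q : Psh M) :
    dayMap (dayAssociatorHom T S R) (𝟙 Q) ≫ dayAssociatorHom T (dayTensor S R) Q ≫
        dayMap (𝟙 T) (dayAssociatorHom S R Q) =
      dayAssociatorHom (dayTensor T S) R Q ≫ dayAssociatorHom T S (dayTensor R Q) :=
  dayTensor_hom_ext₄ fun a b c d x y z w => by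
    simp only [Psh.comp_app, app_dayMap, app_dayAssociatorHom, Psh.app_res, Psh.id_app,
      dayMk_res_left, dayMk_res_right, ← Psh.res_comp, pentagon]

lemma day_triangle (T S : Psh M) :
    dayAssociatorHom T (Psh.representable (𝟙_ M)) S ≫ dayMap (𝟙 T) (dayLeftUnitorHom S) =
      dayMap (dayRightUnitorHom T) (𝟙 S) :=
  dayTensor_hom_ext₃ fun a b c x f y => by
    simp only [Psh.comp_app, app_dayMap, app_dayAssociatorHom, Psh.app_res, Psh.id_app,
      app_dayLeftUnitorHom, app_dayRightUnitorHom, dayMk_res_left, dayMk_res_right,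
      ← Psh.res_comp]
    -- Both sides are restrictions of `dayMk x y`; what remains is an equation in `M` that follows
    -- from its triangle identity and naturality of the associator.
    congr 2
    simp

end DayMonoidal

/-! ### Braiding and inverse associator of Day convolution -/

section DaySymmetric

variable [SymmetricCategory M] {T T' S S' R R' Q Z : Psh M}

/-- The braiding of Day convolution as a morphism. -/
def dayBraidingHom (T S : Psh M) : dayTensor T S ⟶ dayTensor S T :=
  dayBihom_isUniversal.desc (dayBihom S T).flip

lemma app_dayBraidingHom {a b : M} (x : T.ev a) (y : S.ev b) :
    Psh.app (dayBraidingHom T S) (a ⊗ b) (dayMk x y) =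
      (dayTensor S T).res (β_ a b).hom (dayMk y x) := dayBihom_isUniversal.app_desc _ x y

lemma dayBraidingHom_symmetry (T S : Psh M) : dayBraidingHom T S ≫ dayBraidingHom S T = 𝟙 _ :=
  dayTensor_hom_ext fun a b x y => by
    rw [Psh.comp_app, app_dayBraidingHom, Psh.app_res, app_dayBraidingHom, ← Psh.res_comp,
      SymmetricCategory.symmetry, Psh.res_id, Psh.id_app]

/-- The braiding of Day convolution. -/
def dayBraiding (T S : Psh M) : dayTensor T S ≅ dayTensor S T where
  hom := dayBraidingHom T S
  inv := dayBraidingHom S T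
  hom_inv_id := dayBraidingHom_symmetry T S
  inv_hom_id := dayBraidingHom_symmetry S T

lemma dayBraidingHom_naturality (f : T ⟶ T') (g : S ⟶ S') :
    dayMap f g ≫ dayBraidingHom T' S' = dayBraidingHom T S ≫ dayMap g f :=
  dayTensor_hom_ext fun a b x y => by
    simp only [Psh.comp_app, app_dayMap, app_dayBraidingHom, Psh.app_res]

variable [CpoBotMonoidal M]

lemma dayTensor_hom_ext₃' {f g : dayTensor T (dayTensor S R) ⟶ Z}
    (h : ∀ (a b c : M) (x : T.ev a) (y : S.ev b) (z : R.ev c),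
      Psh.app f (a ⊗ b ⊗ c) (dayMk x (dayMk y z)) =
        Psh.app g (a ⊗ b ⊗ c) (dayMk x (dayMk y z))) : f = g := by
  have : (dayBihom T _).comp f = (dayBihom T _).comp g :=
    dayBihom_isUniversal.bihom_ext_right h
  exact dayTensor_hom_ext fun a b x y => congrArg (fun φ => φ.toFun a b x y) this

/-- The inverse associator of Day convolution, obtained from the associator by conjugation with the
braiding. -/
def dayAssociatorInv (T S R : Psh M) :
    dayTensor T (dayTensor S R) ⟶ dayTensor (dayTensor T S) R :=
  dayBraidingHom _ _ ≫ dayMap (dayBraidingHom _ _) (𝟙 T) ≫ dayAssociatorHom R S T ≫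
    dayBraidingHom _ _ ≫ dayMap (dayBraidingHom _ _) (𝟙 R)

/-- Followed through the five factors, a pure tensor is restricted along a composite in `M` that
`braiding_conj_associator` identifies with the inverse associator. -/
lemma app_dayAssociatorInv {a b c : M} (x : T.ev a) (y : S.ev b) (z : R.ev c) :
    Psh.app (dayAssociatorInv T S R) (a ⊗ b ⊗ c) (dayMk x (dayMk y z)) =
      (dayTensor (dayTensor T S) R).res (α_ a b c).inv (dayMk (dayMk x y) z) := by
  simp only [dayAssociatorInv, Psh.comp_app, app_dayBraidingHom, Psh.app_res, app_dayMap,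
    dayMk_res_left, app_dayAssociatorHom, Psh.id_app, ← Psh.res_comp,
    braiding_conj_associator]

/-- The associator of Day convolution. -/
def dayAssociator (T S R : Psh M) :
    dayTensor (dayTensor T S) R ≅ dayTensor T (dayTensor S R) where
  hom := dayAssociatorHom T S R
  inv := dayAssociatorInv T S R
  hom_inv_id := dayTensor_hom_ext₃ fun a b c x y z => by
    rw [Psh.comp_app, app_dayAssociatorHom, Psh.app_res, app_dayAssociatorInv, ← Psh.res_comp,
      Iso.hom_inv_id, Psh.res_id, Psh.id_app]
  inv_hom_id := dayTensor_hom_ext₃' fun a b c x y z => by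
    rw [Psh.comp_app, app_dayAssociatorInv, Psh.app_res, app_dayAssociatorHom, ← Psh.res_comp,
      Iso.inv_hom_id, Psh.res_id, Psh.id_app]

variable (M) in
/-- The operations of the monoidal structure given by Day convolution. -/
@[reducible]
def dayMonoidalStruct : MonoidalCategoryStruct (Psh M) where
  tensorObj := dayTensor
  whiskerLeft T _ _ f := dayMap (𝟙 T) f
  whiskerRight f S := dayMap f (𝟙 S)
  tensorHom := dayMap
  tensorUnit := Psh.representable (𝟙_ M)
  associator := dayAssociator
  leftUnitor := dayLeftUnitor
  rightUnitor := dayRightUnitor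

variable (M) in
/-- The monoidal structure given by Day convolution. -/
@[reducible]
def dayMonoidalCategory : MonoidalCategory (Psh M) :=
  letI := dayMonoidalStruct M
  MonoidalCategory.ofTensorHom (C := Psh M)
    (id_tensorHom_id := fun _ _ => dayMap_id)
    (id_tensorHom := fun _ _ _ _ => rfl)
    (tensorHom_id := fun _ _ => rfl)
    (tensorHom_comp_tensorHom := dayMap_comp)
    (associator_naturality := dayAssociatorHom_naturality)
    (leftUnitor_naturality := dayLeftUnitorHom_naturality)
    (rightUnitor_naturality := dayRightUnitorHom_naturality)
    (pentagon := day_pentagon)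
    (triangle := day_triangle)

lemma day_hexagon_forward (T S R : Psh M) :
    dayAssociatorHom T S R ≫ dayBraidingHom T (dayTensor S R) ≫ dayAssociatorHom S R T =
      dayMap (dayBraidingHom T S) (𝟙 R) ≫ dayAssociatorHom S T R ≫
        dayMap (𝟙 S) (dayBraidingHom T R) :=
  dayTensor_hom_ext₃ fun a b c x y z => by
    simp only [Psh.comp_app, app_dayMap, app_dayAssociatorHom, app_dayBraidingHom, Psh.app_res,
      Psh.id_app, dayMk_res_left, dayMk_res_right, ← Psh.res_comp,
      BraidedCategory.hexagon_forward]

lemma day_hexagon_reverse (T S R : Psh M) :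
    dayAssociatorInv T S R ≫ dayBraidingHom (dayTensor T S) R ≫ dayAssociatorInv R T S =
      dayMap (𝟙 T) (dayBraidingHom S R) ≫ dayAssociatorInv T R S ≫
        dayMap (dayBraidingHom T R) (𝟙 S) :=
  dayTensor_hom_ext₃' fun a b c x y z => by
    simp only [Psh.comp_app, app_dayMap, app_dayAssociatorInv, app_dayBraidingHom, Psh.app_res,
      Psh.id_app, dayMk_res_left, dayMk_res_right, ← Psh.res_comp,
      BraidedCategory.hexagon_reverse]

variable (M) in
/-- The symmetric monoidal structure given by Day convolution. -/
@[reducible]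
def daySymmetricCategory :
    letI := dayMonoidalCategory M
    SymmetricCategory (Psh M) :=
  letI := dayMonoidalCategory M
  { braiding := dayBraiding
    braiding_naturality_right := fun T _ _ f => dayBraidingHom_naturality (𝟙 T) f
    braiding_naturality_left := fun f T => dayBraidingHom_naturality f (𝟙 T)
    hexagon_forward := day_hexagon_forward
    hexagon_reverse := day_hexagon_reverse
    symmetry := dayBraidingHom_symmetry }

variable (M) in
/-- The Day convolution structure on presheaves. -/
def dayConvolution :
    letI := dayMonoidalCategory M
    letI := daySymmetricCategory M
    DayConvolution M :=
  letI := dayMonoidalCategory M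
  letI := daySymmetricCategory M
  { bihom := dayBihom
    existsUnique_desc := dayBihom_isUniversal.existsUnique_desc
    le_of_bihom_le := dayBihom_isUniversal.le_of_le
    unitIso := Iso.refl _
    tensorHom_bihom := fun f g _ _ x y => app_dayMap f g x y
    associator_bihom := fun _ _ _ _ _ _ x y z => app_dayAssociatorHom x y z
    leftUnitor_bihom := fun _ _ _ f x => app_dayLeftUnitorHom f x
    rightUnitor_bihom := fun _ _ _ x f => app_dayRightUnitorHom x f
    braiding_bihom := fun _ _ _ _ x y => app_dayBraidingHom x y }

end DaySymmetric

end Presheaves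

/-! ### The cartesian category of cpos -/

section Cpo

lemma isCpoProducts_cpo : IsCpoProducts ωCPO.{u} := fun X Y Z =>
  continuous_of (α := (Z →𝒄 X) × (Z →𝒄 Y)) (β := Z →𝒄 X × Y)
    (f := fun p => (CartesianMonoidalCategory.lift (show Z ⟶ X from p.1) (show Z ⟶ Y from p.2) :
      Z ⟶ X ⊗ Y))
    (fun _ _ h z => ⟨h.1 z, h.2 z⟩)
    fun c φ h z =>
      ⟨ωSup_le (c.map ⟨fun p => p.1 z, fun _ _ h => h.1 z⟩) (φ z).1 fun i => (h i z).1,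
        ωSup_le (c.map ⟨fun p => p.2 z, fun _ _ h => h.2 z⟩) (φ z).2 fun i => (h i z).2⟩

lemma isCpoTensor_cpo : IsCpoTensor ωCPO.{u} := fun X X' Y Y' =>
  continuous_of (α := (X →𝒄 X') × (Y →𝒄 Y')) (β := X × Y →𝒄 X' × Y')
    (f := fun p => ((show X ⟶ X' from p.1) ⊗ₘ (show Y ⟶ Y' from p.2) : X ⊗ Y ⟶ X' ⊗ Y'))
    (fun _ _ h z => ⟨h.1 z.1, h.2 z.2⟩)
    fun c φ h z =>
      ⟨ωSup_le (c.map ⟨fun p => p.1 z.1, fun _ _ h => h.1 z.1⟩) (φ z).1 fun i => (h i z).1,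
        ωSup_le (c.map ⟨fun p => p.2 z.2, fun _ _ h => h.2 z.2⟩) (φ z).2 fun i => (h i z).2⟩

/-- Currying of Scott continuous functions. -/
def cpoCurry {X Y Z : ωCPO.{u}} : (X × Z →𝒄 Y) ≃ (Z →𝒄 (X →𝒄 Y)) where
  toFun f := ContinuousHom.ofFun
    (fun z => ContinuousHom.ofFun (fun x => f (x, z))
      (f.ωScottContinuous.comp (prodMk_right_continuous z)))
    (continuous_of (fun _ _ h x => f.monotone ⟨le_rfl, h⟩) fun c φ h x =>
      apply_ωSup_le (f.ωScottContinuous.comp (prodMk_left_continuous x)) c (φ x) fun i => h i x)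
  invFun g := ContinuousHom.ofFun (fun p => g p.2 p.1) (by fun_prop)
  left_inv _ := rfl
  right_inv _ := rfl

/-- Taking the product with a cpo has a right adjoint. -/
def cpoTensorLeftAdj (X : ωCPO.{u}) :
    tensorLeft X ⊣ Adjunction.rightAdjointOfEquiv (F := tensorLeft X)
      (G_obj := fun Y => ωCPO.of (X →𝒄 Y)) (fun _ _ => cpoCurry) (fun _ _ _ _ _ => rfl) :=
  Adjunction.adjunctionOfEquivRight _ _

instance (X : ωCPO.{u}) : (tensorLeft X).IsLeftAdjoint := (cpoTensorLeftAdj X).isLeftAdjoint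

/-- The product functor preserves colimits of diagrams of shape `ℕ`. -/
lemma preservesColimit_tensor_cpo (D₁ D₂ : ℕ ⥤ ωCPO.{u}) :
    PreservesColimit (D₁.prod' D₂) (MonoidalCategory.tensor ωCPO.{u}) := by
  -- The diagonal of a sifted category is final, so preservation in each variable separately gives
  -- joint preservation. In the first variable it follows from that in the second by the braiding.
  have : IsSifted ℕ := IsFiltered.isSifted
  have : ∀ X : ωCPO.{u}, PreservesColimit D₂ ((curriedTensor _).obj X) := fun X =>
    (show PreservesColimit D₂ (tensorLeft X) from inferInstance)
  have : ∀ X : ωCPO.{u}, PreservesColimit D₁ ((curriedTensor _).flip.obj X) := fun X =>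
    (show PreservesColimit D₁ (tensorRight X) from inferInstance)
  -- Colimits in a product category are componentwise, so it is enough to treat this cocone.
  let c : Cocone (D₁.prod' D₂) :=
    { pt := (colimit D₁, colimit D₂)
      ι := { app := fun n => Prod.mkHom (colimit.ι D₁ n) (colimit.ι D₂ n)
             naturality := fun _ _ f => Prod.ext ((colimit.cocone D₁).ι.naturality f)
              ((colimit.cocone D₂).ι.naturality f) } }
  let hc : IsColimit c :=
    { desc := fun s => Prod.mkHom (colimit.desc D₁ ((CategoryTheory.Prod.fst _ _).mapCocone s))
        (colimit.desc D₂ ((CategoryTheory.Prod.snd _ _).mapCocone s))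
      fac := fun s n => Prod.ext (colimit.ι_desc _ n) (colimit.ι_desc _ n)
      uniq := fun s m h => Prod.ext
        (colimit.hom_ext fun n => (congrArg Prod.fst (h n)).trans
          (colimit.ι_desc ((CategoryTheory.Prod.fst _ _).mapCocone s) n).symm)
        (colimit.hom_ext fun n => (congrArg Prod.snd (h n)).trans
          (colimit.ι_desc ((CategoryTheory.Prod.snd _ _).mapCocone s) n).symm) }
  exact preservesColimit_of_preserves_colimit_cocone hc
    (IsColimit.tensor (colimit.isColimit D₁) (colimit.isColimit D₂))

end Cpo

section Presheaves

variable {M : Type u} [SmallCategory M] [CpoBotCategory M] [MonoidalCategory M]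

lemma internalHom_hom_ext [CpoBotMonoidal M] {T S Z : Psh M} {f g : S ⟶ internalHom T Z}
    (h : ∀ (a b : M) (x : T.ev a) (y : S.ev b),
      internalHomApp (Psh.app f b y) a x = internalHomApp (Psh.app g b y) a x) : f = g :=
  DayBihom.curryEquiv.symm.injective (DayBihom.ext h)

variable [SymmetricCategory M]

/-! ### The closed structure of a Day convolution -/

namespace DayConvolution

variable [MonoidalCategory (Psh M)] [SymmetricCategory (Psh M)] (D : DayConvolution M)
  {T T' S S' Z Z' : Psh M}

lemma bihom_isUniversal (T S : Psh M) : (D.bihom T S).IsUniversal :=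
  ⟨D.existsUnique_desc, D.le_of_bihom_le⟩

/-- Morphisms out of the tensor product are bistrict families. -/
def homEquivBihom : (T ⊗ S ⟶ Z) ≃ DayBihom T S Z where
  toFun := (D.bihom T S).comp
  invFun := (D.bihom_isUniversal T S).desc
  left_inv _ := (D.bihom_isUniversal T S).hom_ext fun _ _ x y =>
    (D.bihom_isUniversal T S).app_desc _ x y
  right_inv _ := DayBihom.ext fun _ _ x y => (D.bihom_isUniversal T S).app_desc _ x y

include D in
lemma isCpoTensor : IsCpoTensor (Psh M) := fun T T' S S' =>
  (D.bihom_isUniversal T S).continuous_of_app fun a b x y => by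
    -- On pure tensors `f ⊗ₘ g` applies `f` and `g` to the two entries, which is jointly continuous
    -- in `(f, g)`.
    simp only [D.tensorHom_bihom]
    exact (D.bihom T' S').continuous₂
      (Psh.app_continuous (f := fun p : (T ⟶ T') × (S ⟶ S') => p.1) (by fun_prop) a x)
      (Psh.app_continuous (f := fun p : (T ⟶ T') × (S ⟶ S') => p.2) (by fun_prop) b y)

variable [CpoBotMonoidal M]

/-- Morphisms out of the tensor product are morphisms to the internal hom. -/
def tensorHomEquiv : (T ⊗ S ⟶ Z) ≃ (S ⟶ internalHom T Z) :=
  D.homEquivBihom.trans DayBihom.curryEquiv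

lemma internalHomApp_tensorHomEquiv (f : T ⊗ S ⟶ Z) {a b : M} (x : T.ev a) (y : S.ev b) :
    internalHomApp (Psh.app (D.tensorHomEquiv f) b y) a x =
      Psh.app f (a ⊗ b) ((D.bihom T S).toFun a b x y) := rfl

lemma tensorHomEquiv_comp (f : S' ⟶ S) (g : T ⊗ S ⟶ Z) :
    D.tensorHomEquiv ((tensorLeft T).map f ≫ g) = f ≫ D.tensorHomEquiv g :=
  internalHom_hom_ext fun a b x y => by
    rw [internalHomApp_tensorHomEquiv, Psh.comp_app, Psh.comp_app, internalHomApp_tensorHomEquiv]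
    refine congrArg (Psh.app g (a ⊗ b)) ?_
    have h := D.tensorHom_bihom (𝟙 T) f a b x y
    rwa [id_tensorHom, Psh.id_app] at h

lemma tensorHomEquiv_continuous :
    ωScottContinuous (D.tensorHomEquiv : (T ⊗ S ⟶ Z) → (S ⟶ internalHom T Z)) :=
  continuous_of (fun _ _ h _ _ _ _ => h _ _) fun c _ h b y a x =>
    apply_ωSup_le (Psh.app_continuous (f := fun f : T ⊗ S ⟶ Z => f) .id (a ⊗ b)
      ((D.bihom T S).toFun a b x y)) c _ fun i => h i b y a x

/-- Tensoring with a presheaf is left adjoint to the internal hom. -/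
def tensorLeftAdj (T : Psh M) :
    tensorLeft T ⊣ Adjunction.rightAdjointOfEquiv (F := tensorLeft T)
      (G_obj := fun Z => internalHom T Z) (fun _ _ => D.tensorHomEquiv)
      (fun _ _ _ f g => D.tensorHomEquiv_comp f g) :=
  Adjunction.adjunctionOfEquivRight _ _

/-- The closed structure of a Day convolution. -/
@[reducible]
def monoidalClosed : MonoidalClosed (Psh M) where
  closed T := { rightAdj := _, adj := D.tensorLeftAdj T }

lemma curry_eq_tensorHomEquiv (f : T ⊗ S ⟶ Z) :
    letI := D.monoidalClosed
    MonoidalClosed.curry f = D.tensorHomEquiv f := by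
  let := D.monoidalClosed
  have h : (D.tensorLeftAdj T).homEquiv = fun _ _ => D.tensorHomEquiv :=
    Adjunction.mkOfHomEquiv_homEquiv _
  exact congrArg (fun e : ∀ S Z, (T ⊗ S ⟶ Z) ≃ (S ⟶ internalHom T Z) => e S Z f) h

lemma isCpoInternalHom :
    letI := D.monoidalClosed
    IsCpoInternalHom (Psh M) := by
  let := D.monoidalClosed
  intro T T' Z Z'
  -- The action of the internal hom is rewritten as the transpose of evaluation, precomposed with
  -- `p.1 ⊗ 𝟙` and followed by `p.2`. In this form only tensoring, composition and transposition
  -- occur, and all are continuous.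
  have key : ∀ p : (T' ⟶ T) × (Z ⟶ Z'),
      (MonoidalClosed.pre p.1).app Z ≫ (ihom T').map p.2 =
        D.tensorHomEquiv (((p.1 ⊗ₘ 𝟙 ((ihom T).obj Z)) ≫ (ihom.ev T).app Z) ≫ p.2) := by
    intro p
    rw [← curry_eq_tensorHomEquiv]
    apply MonoidalClosed.uncurry_injective
    rw [MonoidalClosed.uncurry_natural_right, MonoidalClosed.uncurry_pre,
      MonoidalClosed.uncurry_curry, tensorHom_id]
  simp only [key]
  have h₁ : ωScottContinuous (fun p : (T' ⟶ T) × (Z ⟶ Z') => p.1 ⊗ₘ 𝟙 ((ihom T).obj Z)) :=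
    (D.isCpoTensor T' T _ _).comp (prodMk_continuous (by fun_prop) .const)
  have h₂ := (comp_right_continuous _ ((ihom.ev T).app Z)).comp h₁
  exact D.tensorHomEquiv_continuous.comp ((CpoCategory.comp_continuous _ _ _).comp
    (prodMk_continuous h₂ (by fun_prop)))

end DayConvolution

end Presheaves

/-- A bijection preserving and reflecting the order is an order isomorphism, and suprema are
determined by the order. -/
lemma equiv_symm_continuous {α β : Type*} [OmegaCompletePartialOrder α]
    [OmegaCompletePartialOrder β] (e : α ≃ β) (hm : Monotone e)
    (hr : ∀ x y, e x ≤ e y → x ≤ y) : ωScottContinuous e.symm :=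
  continuous_of (fun x y h => hr _ _ (by simpa using h)) fun c z h => hr _ _ (by
    rw [e.apply_symm_apply]
    exact ωSup_le _ _ fun i => by simpa using hm (h i))

section Presheaves

variable {M : Type u} [SmallCategory M] [CpoBotCategory M]

/-! ### The composite adjunction -/

section Adjunction

variable [MonoidalCategory (Psh M)] {X Y : ωCPO.{u}} {T S Z : Psh M}

/-- The generalized element of `X_⊥ ⊙ I` given by an element of `X`. -/
def point (X : ωCPO.{u}) : X →𝒄 (𝟙_ (Psh M) ⟶ (linF M).obj X) := (compositeAdj M).unit.app X

lemma point_comp (x : X) (f : (linF M).obj X ⟶ T) :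
    point X x ≫ f =
      (show X →𝒄 (𝟙_ (Psh M) ⟶ T) from (compositeAdj M).homEquiv X T f) x := by
  rw [Adjunction.homEquiv_unit]
  rfl

lemma point_comp_map (f : X →𝒄 Y) (x : X) :
    point X x ≫ (linF M).map (show X ⟶ Y from f) = point Y (f x) :=
  (ContinuousHom.congr_fun ((compositeAdj M).unit.naturality (show X ⟶ Y from f)) x).symm

lemma point_comp_homEquiv_symm (f : X →𝒄 (𝟙_ (Psh M) ⟶ T)) (x : X) :
    point X x ≫ ((compositeAdj M).homEquiv X T).symm f = f x :=
  (point_comp x _).trans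
    (ContinuousHom.congr_fun (((compositeAdj M).homEquiv X T).apply_symm_apply f) x)

/-- A smash product has no elements besides classes of pairs, and an element of `X_⊥` is `⊥` or
comes from `X`. Points are therefore jointly surjective away from `⊥`, and all comparisons of
morphisms out of `F X` reduce to them. -/
lemma linF_ev_cases {a : M} (p : ((linF M).obj X).ev a) :
    p = ⊥ ∨ ∃ (x : X) (i : (𝟙_ (Psh M)).ev a), p = Psh.app (point X x) a i := by
  have key : ∀ (w : WithBot X) (i : (𝟙_ (Psh M)).ev a), smashMk w i = p →
      p = ⊥ ∨ ∃ (x : X) (i : (𝟙_ (Psh M)).ev a), p = Psh.app (point X x) a i := by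
    intro w i h
    induction w with
    | bot => exact .inl (h.symm.trans (smashMk_bot_left _))
    | coe x => exact .inr ⟨x, i, h.symm⟩
  exact key _ _ (smashMk_val p)

lemma linF_le {f g : (linF M).obj X ⟶ T} (h : ∀ x, point X x ≫ f ≤ point X x ≫ g) : f ≤ g := by
  intro a p
  obtain rfl | ⟨x, i, rfl⟩ := linF_ev_cases p
  · exact (Psh.app_bot f a).le.trans bot_le
  · exact h x a i

lemma linF_hom_ext {f g : (linF M).obj X ⟶ T} (h : ∀ x, point X x ≫ f = point X x ≫ g) : f = g :=
  le_antisymm (linF_le fun x => (h x).le) (linF_le fun x => (h x).ge)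

lemma isCpoFunctor_linF : IsCpoFunctor (linF M) := fun X Y => by
  have h : ∀ x : X, ωScottContinuous
      (fun f : X →𝒄 Y => point X x ≫ (linF M).map (show X ⟶ Y from f)) := fun x => by
    -- At a fixed point, `F f` is just evaluation of `f` at `x` followed by `point`, visibly
    -- continuous in `f`.
    simp only [point_comp_map]
    fun_prop
  exact continuous_of (α := X →𝒄 Y) (fun _ _ hf => linF_le fun x => (h x).monotone hf)
    fun c z hz => linF_le fun x =>
      apply_ωSup_le (h x) c _ fun i => comp_le_comp le_rfl (hz i)

lemma isCpoFunctor_linG : IsCpoFunctor (linG M) := fun T S =>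
  continuous_of (β := (𝟙_ (Psh M) ⟶ T) →𝒄 (𝟙_ (Psh M) ⟶ S))
    (fun _ _ h _ => comp_le_comp le_rfl h)
    fun c _ h f => apply_ωSup_le (comp_left_continuous S f) c _ fun i => h i f

lemma compositeAdj_homEquiv_continuous (X : ωCPO.{u}) (T : Psh M) :
    ωScottContinuous ((compositeAdj M).homEquiv X T) :=
  continuous_of (β := X →𝒄 (𝟙_ (Psh M) ⟶ T))
    (fun f g h x => ((point_comp x f).symm.le.trans (comp_le_comp le_rfl h)).trans
      (point_comp x g).le)
    fun c _ h x => (point_comp x _).symm.le.trans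
      (apply_ωSup_le (comp_left_continuous T (point X x)) c _ fun i =>
        (point_comp x _).le.trans (h i x))

lemma compositeAdj_homEquiv_symm_continuous (X : ωCPO.{u}) (T : Psh M) :
    ωScottContinuous ((compositeAdj M).homEquiv X T).symm :=
  equiv_symm_continuous _ (compositeAdj_homEquiv_continuous X T).monotone fun f g h =>
    linF_le fun x => (point_comp x f).le.trans ((h x).trans (point_comp x g).symm.le)

end Adjunction

/-! ### Monoidal structures on the adjunction -/

section UnitHoms

variable {C : Type u₁} [Category.{v₁} C] [MonoidalCategory C] {X Y Z : C}

lemma unit_tensorHom_comp {X' Y' : C} (p : 𝟙_ C ⟶ X) (q : 𝟙_ C ⟶ Y) (f : X ⟶ X') (g : Y ⟶ Y') :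
    (λ_ (𝟙_ C)).inv ≫ ((p ≫ f) ⊗ₘ (q ≫ g)) = ((λ_ (𝟙_ C)).inv ≫ (p ⊗ₘ q)) ≫ (f ⊗ₘ g) := by
  rw [Category.assoc, tensorHom_comp_tensorHom]

/-- The left and right unitors agree on the unit object, so the two ways of splitting it into three
copies correspond under the associator. -/
lemma unit_tensorHom_associator (f : 𝟙_ C ⟶ X) (g : 𝟙_ C ⟶ Y) (h : 𝟙_ C ⟶ Z) :
    ((λ_ (𝟙_ C)).inv ≫ (((λ_ (𝟙_ C)).inv ≫ (f ⊗ₘ g)) ⊗ₘ h)) ≫ (α_ X Y Z).hom =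
      (λ_ (𝟙_ C)).inv ≫ (f ⊗ₘ ((λ_ (𝟙_ C)).inv ≫ (g ⊗ₘ h))) := by
  simp only [Category.assoc, Iso.cancel_iso_inv_left]
  conv_lhs =>
    rw [← Category.id_comp h, ← tensorHom_comp_tensorHom, Category.assoc, associator_naturality,
      ← Category.assoc, unitors_inv_equal, tensorHom_id, triangle_assoc_comp_right_inv]
  conv_rhs => rw [← Category.id_comp f, ← tensorHom_comp_tensorHom]
  simp

lemma unit_tensorHom_leftUnitor (f : 𝟙_ C ⟶ X) :
    ((λ_ (𝟙_ C)).inv ≫ (𝟙 (𝟙_ C) ⊗ₘ f)) ≫ (λ_ X).hom = f := by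
  simp

lemma unit_tensorHom_rightUnitor (f : 𝟙_ C ⟶ X) :
    ((λ_ (𝟙_ C)).inv ≫ (f ⊗ₘ 𝟙 (𝟙_ C))) ≫ (ρ_ X).hom = f := by
  simp [unitors_inv_equal]

lemma unit_tensorHom_braiding [BraidedCategory C] (f : 𝟙_ C ⟶ X) (g : 𝟙_ C ⟶ Y) :
    ((λ_ (𝟙_ C)).inv ≫ (f ⊗ₘ g)) ≫ (β_ X Y).hom = (λ_ (𝟙_ C)).inv ≫ (g ⊗ₘ f) := by
  rw [Category.assoc, BraidedCategory.braiding_naturality, ← Category.assoc]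
  congr 1
  -- The braiding of the unit with itself is absorbed because it exchanges the two unitors, which
  -- coincide there.
  rw [Iso.inv_comp_eq, ← cancel_mono (ρ_ (𝟙_ C)).hom, braiding_rightUnitor,
    Iso.hom_inv_id, Category.id_comp, unitors_equal]

end UnitHoms

variable [MonoidalCategory M] [SymmetricCategory M]

namespace DayConvolution

variable [MonoidalCategory (Psh M)] [SymmetricCategory (Psh M)] (D : DayConvolution M)
  {X Y : ωCPO.{u}} {T S Z : Psh M}

-- Morphisms out of the tensor product are tested on pairs of elements. A pair with a `⊥` entry goes
-- to `⊥` by bistrictness, and any other pair comes from a pair of points.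
include D in
lemma linF_tensor_hom_ext {f g : (linF M).obj X ⊗ (linF M).obj Y ⟶ Z}
    (h : ∀ x y, (point X x ⊗ₘ point Y y) ≫ f = (point X x ⊗ₘ point Y y) ≫ g) : f = g := by
  refine (D.bihom_isUniversal _ _).hom_ext fun a b p q => ?_
  obtain rfl | ⟨x, i, rfl⟩ := linF_ev_cases p
  · rw [(D.bihom _ _).bot_left, Psh.app_bot, Psh.app_bot]
  obtain rfl | ⟨y, j, rfl⟩ := linF_ev_cases q
  · rw [(D.bihom _ _).bot_right, Psh.app_bot, Psh.app_bot]
  rw [← D.tensorHom_bihom, ← Psh.comp_app, ← Psh.comp_app, h]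

/-- The standard lax structure map of the right adjoint. -/
def linGTensor (T S : Psh M) :
    (𝟙_ (Psh M) ⟶ T) × (𝟙_ (Psh M) ⟶ S) →𝒄 (𝟙_ (Psh M) ⟶ T ⊗ S) :=
  ContinuousHom.ofFun (fun p => (λ_ (𝟙_ (Psh M))).inv ≫ (p.1 ⊗ₘ p.2))
    ((comp_left_continuous _ _).comp (D.isCpoTensor _ _ _ _))

/-- The standard lax monoidal structure on the right adjoint. -/
@[reducible]
def linGLaxMonoidal : (linG M).LaxMonoidal :=
  Functor.LaxMonoidal.ofTensorHom
    (ε := (ContinuousHom.const (𝟙 (𝟙_ (Psh M))) : PUnit.{u + 1} →𝒄 (𝟙_ (Psh M) ⟶ 𝟙_ (Psh M))))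
    (μ := fun T S => D.linGTensor T S)
    (μ_natural := fun f g => ContinuousHom.ext _ _ fun p =>
      unit_tensorHom_comp p.1 p.2 f g)
    (associativity := fun _ _ _ => ContinuousHom.ext _ _ fun p =>
      unit_tensorHom_associator p.1.1 p.1.2 p.2)
    (left_unitality := fun _ => ContinuousHom.ext _ _ fun p =>
      (unit_tensorHom_leftUnitor p.2).symm)
    (right_unitality := fun _ => ContinuousHom.ext _ _ fun p =>
      (unit_tensorHom_rightUnitor p.1).symm)

/-- The standard lax structure on the right adjoint is symmetric. -/
@[reducible]
def linGLaxBraided : (linG M).LaxBraided where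
  toLaxMonoidal := D.linGLaxMonoidal
  braided _ _ := ContinuousHom.ext _ _ fun p => unit_tensorHom_braiding p.1 p.2

/-! ### Strong monoidality of the left adjoint and the monoidal adjunction -/

/-- The oplax monoidal structure on the left adjoint. -/
@[reducible]
def linFOplaxMonoidal : (linF M).OplaxMonoidal :=
  letI := D.linGLaxMonoidal
  (compositeAdj M).leftAdjointOplaxMonoidal

lemma point_comp_η :
    letI := D.linFOplaxMonoidal
    point (𝟙_ ωCPO.{u}) PUnit.unit ≫ Functor.OplaxMonoidal.η (linF M) = 𝟙 _ :=
  point_comp_homEquiv_symm _ _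

/-- The oplax map is by construction the transpose of the lax map of `G` applied to the units of the
adjunction, so on points it is the standard formula. -/
lemma point_comp_δ (x : X) (y : Y) :
    letI := D.linFOplaxMonoidal
    point (X ⊗ Y) (x, y) ≫ Functor.OplaxMonoidal.δ (linF M) X Y =
      (λ_ (𝟙_ (Psh M))).inv ≫ (point X x ⊗ₘ point Y y) :=
  point_comp_homEquiv_symm _ _

lemma δ_braiding (X Y : ωCPO.{u}) :
    letI := D.linFOplaxMonoidal
    Functor.OplaxMonoidal.δ (linF M) X Y ≫ (β_ _ _).hom =
      (linF M).map (β_ X Y).hom ≫ Functor.OplaxMonoidal.δ (linF M) Y X := by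
  let := D.linFOplaxMonoidal
  refine linF_hom_ext fun p => ?_
  rw [← Category.assoc, ← Category.assoc, show point _ p ≫ Functor.OplaxMonoidal.δ (linF M) X Y = _
    from D.point_comp_δ p.1 p.2, unit_tensorHom_braiding]
  refine (D.point_comp_δ p.2 p.1).symm.trans (congrArg (· ≫ _) ?_)
  exact (point_comp_map (X := X ⊗ Y) (Y := Y ⊗ X) (β_ X Y).hom p).symm

variable [CpoBotMonoidal M]

/-- The functions `x ↦ (x, y)`. -/
def cpoPair (X Y : ωCPO.{u}) : Y →𝒄 (X →𝒄 X × Y) := cpoCurry (Y := ωCPO.of (X × Y)) ContinuousHom.id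

/-- The inverse of the oplax structure map of the left adjoint. -/
def linFTensor (X Y : ωCPO.{u}) :
    (linF M).obj X ⊗ (linF M).obj Y ⟶ (linF M).obj (X ⊗ Y) :=
  -- Transposing first along the tensor product and then along `F ⊣ G` reduces the task to a
  -- continuous map from `Y` to morphisms `I ⟶ [F X, F (X × Y)]`. The element `y` goes to the
  -- transpose of `F X ⊗ I ≅ F X ⟶ F (X × Y)`, where the last map is `F` of `x ↦ (x, y)`.
  D.tensorHomEquiv.symm (((compositeAdj M).homEquiv _ _).symm
    (ContinuousHom.ofFun (β := 𝟙_ (Psh M) ⟶ internalHom ((linF M).obj X) ((linF M).obj (X ⊗ Y)))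
      (fun y : Y => D.tensorHomEquiv ((ρ_ _).hom ≫
        (linF M).map (show X ⟶ X ⊗ Y from cpoPair X Y y)))
      (D.tensorHomEquiv_continuous.comp ((comp_left_continuous _ _).comp
        ((isCpoFunctor_linF _ _).comp (cpoPair X Y).ωScottContinuous)))))

lemma tensorHom_point_comp_linFTensor (x : X) (y : Y) :
    (point X x ⊗ₘ point Y y) ≫ D.linFTensor X Y =
      (λ_ (𝟙_ (Psh M))).hom ≫ point (X ⊗ Y) (x, y) := by
  have h : (linF M).obj X ◁ point Y y ≫ D.linFTensor X Y =
      (ρ_ _).hom ≫ (linF M).map (show X ⟶ X ⊗ Y from cpoPair X Y y) := by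
    -- After transposition, precomposing with the point of `y` evaluates the defining function at
    -- `y`.
    apply D.tensorHomEquiv.injective
    refine (D.tensorHomEquiv_comp (point Y y) _).trans ?_
    rw [linFTensor, Equiv.apply_symm_apply, point_comp_homEquiv_symm]
    rfl
  rw [MonoidalCategory.tensorHom_def, Category.assoc, h, rightUnitor_naturality_assoc,
    point_comp_map, unitors_equal]
  rfl

/-- The inverse is the point of `F 1` given by the unique element of the one-point cpo. -/
instance isIso_η :
    letI := D.linFOplaxMonoidal
    IsIso (Functor.OplaxMonoidal.η (linF M)) :=
  letI := D.linFOplaxMonoidal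
  ⟨point (𝟙_ ωCPO.{u}) PUnit.unit,
    linF_hom_ext fun x => (by
      rw [← Category.assoc, show point _ x ≫ Functor.OplaxMonoidal.η (linF M) = _ from
        D.point_comp_η, Category.id_comp, Category.comp_id]
      rfl),
    D.point_comp_η⟩

lemma isIso_δ (X Y : ωCPO.{u}) :
    letI := D.linFOplaxMonoidal
    IsIso (Functor.OplaxMonoidal.δ (linF M) X Y) :=
  letI := D.linFOplaxMonoidal
  ⟨D.linFTensor X Y,
    linF_hom_ext fun p => (by
      rw [← Category.assoc, show point _ p ≫ Functor.OplaxMonoidal.δ (linF M) X Y = _ from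
        D.point_comp_δ p.1 p.2, Category.assoc, tensorHom_point_comp_linFTensor,
        Iso.inv_hom_id_assoc, Category.comp_id]
      rfl),
    D.linF_tensor_hom_ext fun x y => (by
      rw [← Category.assoc, tensorHom_point_comp_linFTensor, Category.assoc, point_comp_δ,
        Iso.hom_inv_id_assoc, Category.comp_id])⟩

/-- The monoidal structure on the left adjoint. -/
@[reducible]
def linFMonoidal : (linF M).Monoidal :=
  letI := D.linFOplaxMonoidal
  haveI := D.isIso_η
  haveI := D.isIso_δ
  Functor.Monoidal.ofOplaxMonoidal (linF M)

/-- The lax structure on the left adjoint is symmetric. -/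
@[reducible]
def linFLaxBraided : (linF M).LaxBraided :=
  letI := D.linFMonoidal
  { toLaxMonoidal := inferInstance
    braided := fun X Y => by
      -- The lax map is inverse to `δ`, so compatibility with the braiding may be checked after
      -- precomposing with `δ`, where it is `δ_braiding`.
      rw [← cancel_epi (Functor.OplaxMonoidal.δ (linF M) X Y),
        Functor.Monoidal.δ_μ_assoc]
      have h : Functor.OplaxMonoidal.δ (linF M) X Y ≫ (β_ _ _).hom =
        (linF M).map (β_ X Y).hom ≫ Functor.OplaxMonoidal.δ (linF M) Y X := D.δ_braiding X Y
      rw [← Category.assoc, h, Category.assoc, Functor.Monoidal.δ_μ, Category.comp_id] }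

lemma isMonoidal_unit_counit :
    letI := D.linFLaxBraided
    letI := D.linGLaxBraided
    NatTrans.IsMonoidal (compositeAdj M).unit ∧ NatTrans.IsMonoidal (compositeAdj M).counit := by
  let := D.linFMonoidal
  let := D.linGLaxMonoidal
  -- The oplax part of `linFMonoidal` is the structure induced from `G`, for which the adjunction is
  -- monoidal by construction. Both compatibilities transfer, and monoidality of the unit and counit
  -- follows.
  have : (compositeAdj M).IsMonoidal :=
    ⟨(inferInstance : letI := D.linFOplaxMonoidal; (compositeAdj M).IsMonoidal).leftAdjoint_ε,
      (inferInstance : letI := D.linFOplaxMonoidal; (compositeAdj M).IsMonoidal).leftAdjoint_μ⟩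
  exact ⟨inferInstanceAs (NatTrans.IsMonoidal (compositeAdj M).unit),
    inferInstanceAs (NatTrans.IsMonoidal (compositeAdj M).counit)⟩

/-- The `CPO`-LNL model given by a Day convolution. -/
def cpoLNLModel : CpoLNLModel (compositeAdj M) where
  closed := D.monoidalClosed
  cpoTensor_L := D.isCpoTensor
  cpoHom_L := D.isCpoInternalHom
  hasFiniteCoproducts_L := inferInstance
  cpoCoproducts_L := isCpoCoproducts_psh
  cpoTensor_C := isCpoTensor_cpo
  cpoProducts_C := isCpoProducts_cpo
  hasFiniteCoproducts_C := inferInstance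
  cpoCoproducts_C := isCpoCoproducts_cpo
  cpoFunctor_F := isCpoFunctor_linF
  cpoFunctor_G := isCpoFunctor_linG
  homEquiv_continuous := compositeAdj_homEquiv_continuous
  homEquiv_symm_continuous := compositeAdj_homEquiv_symm_continuous
  laxBraided_F := D.linFLaxBraided
  laxBraided_G := D.linGLaxBraided
  isMonoidal_unit := D.isMonoidal_unit_counit.1
  isMonoidal_counit := D.isMonoidal_unit_counit.2
  exists_eInitial := ⟨pshZero, isEInitial_of_isInitial pshZeroIsInitial⟩
  hasColimit_embeddings D _ := hasColimit_psh D
  hasColimit_preEmbeddings _ _ := inferInstance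
  preservesColimit_product D₁ D₂ _ _ := preservesColimit_tensor_cpo D₁ D₂

end DayConvolution

end Presheaves

end CpoLNL

/-! ### The main theorem -/

theorem mainTheorem12 (M : Type u) [SmallCategory M] [CpoLNL.CpoBotCategory M]
    [MonoidalCategory M] [SymmetricCategory M] [CpoLNL.CpoBotMonoidal M] :
    (∃ (_ : MonoidalCategory (CpoLNL.Psh M)) (_ : SymmetricCategory (CpoLNL.Psh M)),
      Nonempty (CpoLNL.DayConvolution M)) ∧
    (∀ [MonoidalCategory (CpoLNL.Psh M)] [SymmetricCategory (CpoLNL.Psh M)]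
      (_ : CpoLNL.DayConvolution M),
      ∃ m : CpoLNL.CpoLNLModel (CpoLNL.compositeAdj M),
        CpoLNL.IsStandardLax m.laxBraided_G.toLaxMonoidal) :=
  ⟨⟨CpoLNL.dayMonoidalCategory M, CpoLNL.daySymmetricCategory M, ⟨CpoLNL.dayConvolution M⟩⟩,
    -- The lax structure on `G` was taken to be the standard one and that on `F` derived from it, so
    -- both formulas hold by definition.
    fun D => ⟨D.cpoLNLModel, rfl, fun _ _ _ _ => rfl⟩⟩
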